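/- Let $\mathcal C$ be the set of bivariate copulas on $[0,1]^2$, let $W(a,b)=\max\{0,a+b-1\}$ and $M(a,b)=\min\{a,b\}$, and for a copula, or more generally a quasi-copula, $Q$ put $$\gamma(Q)=4\int_0^1\bigl(Q(t,t)+Q(t,1-t)\bigr)\,dt-2$$ (Gini's gamma). For $\gamma\in[-1,1]$ let $\overline G_\gamma(a,b)=\sup\{C(a,b): C\in\mathcal C,\ \gamma(C)=\gamma\}$, $(a,b)\in[0,1]^2$, be the pointwise supremum of all copulas with Gini's gamma equal to $\gamma$. Put $$\omega_{a,b}(\gamma)=\tfrac12\Bigl(a+b-1+\tfrac{\sqrt3}{3}\sqrt{5(a+b-1)^2-2(1-2a)(1-2b)+2(1+\gamma)}\Bigr).$$ Then: (i) $\overline G_{-1}=W$, and $\overline G_\gamma=M$ for $\gamma\in[\frac12,1]$. (ii) For every $\gamma\in(-1,0)$, $\overline G_\gamma$ is a proper quasi-copula, i.e. a quasi-copula that is not a copula. (iii) For every $\gamma\in[0,\frac12)$, $\overline G_\gamma$ is a copula different from $W$ and $M$. It is not absolutely continuous. Let $R_\gamma=\{(a,b)\in\mathbb R^2:\omega_{a,b}(\gamma)<a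 \text{ and } \omega_{a,b}(\gamma)<b\}$; this is a nonempty connected open subset of $[0,1]^2$ whose boundary is contained in the union of the graphs of the hyperbolas $\omega_{a,b}(\gamma)=a$ and $\omega_{a,b}(\gamma)=b$, i.e. it is the bounded region enclosed by them. In the Lebesgue decomposition of the probability measure with distribution function $\overline G_\gamma$, the absolutely continuous part gives no mass to the complement of $R_\gamma$ and its support is $\overline{R_\gamma}$, and the support of the singular part is the union of $\partial R_\gamma$ and of the part of the diagonal $\{(a,a):0\le a\le 1\}$ outside $\overline{R_\gamma}$. (iv) $\overline G_\gamma$ is increasing (in the weak sense) in $\gamma\in[-1,1]$ for the concordance order: if $\gamma\le\gamma'$, then $\overline G_\gamma\le\overline G_{\gamma'}$ and $\widehat{\overline G}_\gamma\le\widehat{\overline G}_{\gamma'}$ on $[0,1]^2$, where $\widehat Q(a,b)=a+b-1+Q(1-a,1-b)$. (v) For every $\gamma\in[-1,1]$, $\overline G_\gamma$ is symmetric and radially symmetric: $\overline G_\gamma(a,b)=\overline G_\gamma(b,a)$ and $\overline G_\gamma(a,b)=\widehat{\overline G}_\gamma(a,b)$ for all $(a,b)\in[0,1]^2$. (vi)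 $\gamma(\overline G_\gamma)>\gamma$ for all $\gamma\in(-1,1)$. -/

import Mathlib

open Set MeasureTheory

noncomputable section

namespace GiniBound

/- Functions on the unit square `[0,1]²` are represented by functions `ℝ → ℝ → ℝ`; only their
values on `[0,1]²` matter in every notion below. -/

/-- Bivariate copulas: grounded, with uniform margins, and `2`-increasing on `[0,1]²`. -/
structure IsCopula (C : ℝ → ℝ → ℝ) : Prop where
  zero_left : ∀ v ∈ Icc (0 : ℝ) 1, C 0 v = 0
  zero_right : ∀ u ∈ Icc (0 : ℝ) 1, C u 0 = 0
  one_left : ∀ v ∈ Icc (0 : ℝ) 1, C 1 v = v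
  one_right : ∀ u ∈ Icc (0 : ℝ) 1, C u 1 = u
  two_increasing : ∀ u₁ ∈ Icc (0 : ℝ) 1, ∀ u₂ ∈ Icc (0 : ℝ) 1,
    ∀ v₁ ∈ Icc (0 : ℝ) 1, ∀ v₂ ∈ Icc (0 : ℝ) 1, u₁ ≤ u₂ → v₁ ≤ v₂ →
      0 ≤ C u₂ v₂ - C u₁ v₂ - C u₂ v₁ + C u₁ v₁

/-- Bivariate quasi-copulas: the boundary conditions of a copula, monotone in each variable, and
`1`-Lipschitz with respect to the `ℓ¹` distance. -/
structure IsQuasiCopula (Q : ℝ → ℝ → ℝ) : Prop where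
  zero_left : ∀ v ∈ Icc (0 : ℝ) 1, Q 0 v = 0
  zero_right : ∀ u ∈ Icc (0 : ℝ) 1, Q u 0 = 0
  one_left : ∀ v ∈ Icc (0 : ℝ) 1, Q 1 v = v
  one_right : ∀ u ∈ Icc (0 : ℝ) 1, Q u 1 = u
  mono_left : ∀ u₁ ∈ Icc (0 : ℝ) 1, ∀ u₂ ∈ Icc (0 : ℝ) 1, ∀ v ∈ Icc (0 : ℝ) 1,
    u₁ ≤ u₂ → Q u₁ v ≤ Q u₂ v
  mono_right : ∀ u ∈ Icc (0 : ℝ) 1, ∀ v₁ ∈ Icc (0 : ℝ) 1, ∀ v₂ ∈ Icc (0 : ℝ) 1,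
    v₁ ≤ v₂ → Q u v₁ ≤ Q u v₂
  lipschitz : ∀ u₁ ∈ Icc (0 : ℝ) 1, ∀ u₂ ∈ Icc (0 : ℝ) 1,
    ∀ v₁ ∈ Icc (0 : ℝ) 1, ∀ v₂ ∈ Icc (0 : ℝ) 1,
      |Q u₁ v₁ - Q u₂ v₂| ≤ |u₁ - u₂| + |v₁ - v₂|

/-- A proper quasi-copula is a quasi-copula that is not a copula. -/
def IsProperQuasiCopula (Q : ℝ → ℝ → ℝ) : Prop := IsQuasiCopula Q ∧ ¬ IsCopula Q

/-- The Fréchet–Hoeffding lower bound. -/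
def W (u v : ℝ) : ℝ := max 0 (u + v - 1)

/-- The Fréchet–Hoeffding upper bound. -/
def M (u v : ℝ) : ℝ := min u v

/-- Equality as functions on the unit square. -/
def EqOnSquare (C D : ℝ → ℝ → ℝ) : Prop :=
  ∀ u ∈ Icc (0 : ℝ) 1, ∀ v ∈ Icc (0 : ℝ) 1, C u v = D u v

/-- Reflection in the first variable. -/
def reflectFst (C : ℝ → ℝ → ℝ) (u v : ℝ) : ℝ := v - C (1 - u) v

/-- Reflection in the second variable. -/
def reflectSnd (C : ℝ → ℝ → ℝ) (u v : ℝ) : ℝ := u - C u (1 - v)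

/-- The survival function, obtained by performing both reflections. -/
def survival (C : ℝ → ℝ → ℝ) : ℝ → ℝ → ℝ := reflectSnd (reflectFst C)

/-- The concordance order. -/
def ConcordanceLE (C D : ℝ → ℝ → ℝ) : Prop :=
  ∀ u ∈ Icc (0 : ℝ) 1, ∀ v ∈ Icc (0 : ℝ) 1, C u v ≤ D u v ∧ survival C u v ≤ survival D u v

/-- Symmetry: `C` equals its transpose. -/
def IsSymmetric (C : ℝ → ℝ → ℝ) : Prop := EqOnSquare C (fun u v => C v u)

/-- Radial symmetry: `C` equals its survival function. -/
def IsRadiallySymmetric (C : ℝ → ℝ → ℝ) : Prop := EqOnSquare C (survival C)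

/-- Gini's gamma of a copula and, by the same formula, of a quasi-copula. -/
def gini (Q : ℝ → ℝ → ℝ) : ℝ := 4 * (∫ t in (0 : ℝ)..1, (Q t t + Q t (1 - t))) - 2

/-- The copulas with a given value of Gini's gamma. -/
def giniClass (γ : ℝ) : Set (ℝ → ℝ → ℝ) := {C | IsCopula C ∧ gini C = γ}

/-- The pointwise supremum of the copulas with a given value of Gini's gamma. -/
def upperBound (γ : ℝ) (a b : ℝ) : ℝ := sSup ((fun C : ℝ → ℝ → ℝ => C a b) '' giniClass γ)

/-- The function whose equations `omega γ a b = a` and `omega γ a b = b` define two hyperbolas. -/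
def omega (γ a b : ℝ) : ℝ :=
  1 / 2 * (a + b - 1 + √3 / 3 *
    √(5 * (a + b - 1) ^ 2 - 2 * (1 - 2 * a) * (1 - 2 * b) + 2 * (1 + γ)))

/-- The two hyperbolas. -/
def hyperbolas (γ : ℝ) : Set (ℝ × ℝ) :=
  {p | omega γ p.1 p.2 = p.1} ∪ {p | omega γ p.1 p.2 = p.2}

/-- The open region between the two hyperbolas. -/
def region (γ : ℝ) : Set (ℝ × ℝ) :=
  {p | omega γ p.1 p.2 < p.1 ∧ omega γ p.1 p.2 < p.2}

/-- The main diagonal of the unit square. -/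
def diagonal : Set (ℝ × ℝ) := {p | p.1 = p.2 ∧ p.1 ∈ Icc (0 : ℝ) 1}

/-- `μ` is the mass distribution of `C`: the probability measure on the unit square whose
distribution function is `C`. -/
structure IsMassDistribution (C : ℝ → ℝ → ℝ) (μ : Measure (ℝ × ℝ)) : Prop where
  prob : IsProbabilityMeasure μ
  compl_square : μ (Icc (0 : ℝ) 1 ×ˢ Icc (0 : ℝ) 1)ᶜ = 0
  apply_rect : ∀ u ∈ Icc (0 : ℝ) 1, ∀ v ∈ Icc (0 : ℝ) 1,
    μ (Icc (0 : ℝ) u ×ˢ Icc (0 : ℝ) v) = ENNReal.ofReal (C u v)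

/-- The absolutely continuous part of a measure on the plane. -/
def acPart (μ : Measure (ℝ × ℝ)) : Measure (ℝ × ℝ) := volume.withDensity (μ.rnDeriv volume)

/-- The singular component of a measure on the plane. -/
def singPart (μ : Measure (ℝ × ℝ)) : Measure (ℝ × ℝ) := μ.singularPart volume

end GiniBound

end

noncomputable section

namespace GiniBound


/-! Among copulas taking the value `d` at `(a, b)` there is a smallest one, `minCopula a b d`, and
Gini's gamma is monotone. A value `d` is therefore out of reach at `(a, b)` as soon as `minCopula a
b d` has gamma above `γ`. Conversely, a copula with gamma at most `γ` can be mixed with `M` until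
its gamma is exactly `γ`, which only raises its values. Near the diagonal `gini_minCopula` computes
the gamma as `6 d (d - (a + b - 1)) - (a - b)² - 1`, and `omega` is the positive root of the
equation setting this equal to `γ`. For `γ ≥ 0` the constraint bites only where that formula is
valid, so the supremum is `min (min a b) omega` (`upperBound_eq_min`).

The copula property depends on the sign of the mixed derivative of `omega`, whose numerator is `(a -
b)² + (1 + γ)/3 - (a + b - 1)²`. On the diagonal inside the region, `(a + b - 1)²` takes exactly the
values below `1/3 - 2γ/3`. Hence for `γ < 0` the numerator is negative near a diagonal point with
`(a + b - 1)² = 1/3`, and a small square there has negative volume; for `γ ≥ 0` it is positive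
throughout the region (`density_pos`).

In the latter case each vertical slice of the bound has first-variable derivative `0` below the
region, `omegaFst` inside it and `1` above it. As a function of the height this is a distribution
function with a density inside and atoms on the two boundary curves (`lintegral_acDensity_add`).
Integrating over the slices gives the mass distribution with its Lebesgue decomposition, together
with the copula property. Symmetries and order come from operations preserving the class of copulas
with given gamma; the strict inequality for gamma comes from two members of the class that differ on
the diagonal. -/

/-! ### Elementary properties of copulas and quasi-copulas -/

lemma IsCopula.mono_right {C : ℝ → ℝ → ℝ} (h : IsCopula C) {u v₁ v₂ : ℝ} (hu : u ∈ Icc (0 : ℝ) 1)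
    (h₁ : v₁ ∈ Icc (0 : ℝ) 1) (h₂ : v₂ ∈ Icc (0 : ℝ) 1) (hv : v₁ ≤ v₂) : C u v₁ ≤ C u v₂ := by
  have := h.two_increasing 0 (by simp) u hu v₁ h₁ v₂ h₂ hu.1 hv
  rw [h.zero_left _ h₁, h.zero_left _ h₂] at this
  linarith

lemma IsCopula.mono_left {C : ℝ → ℝ → ℝ} (h : IsCopula C) {u₁ u₂ v : ℝ} (h₁ : u₁ ∈ Icc (0 : ℝ) 1)
    (h₂ : u₂ ∈ Icc (0 : ℝ) 1) (hv : v ∈ Icc (0 : ℝ) 1) (hu : u₁ ≤ u₂) : C u₁ v ≤ C u₂ v := by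
  have := h.two_increasing u₁ h₁ u₂ h₂ 0 (by simp) v hv hu hv.1
  rw [h.zero_right _ h₁, h.zero_right _ h₂] at this
  linarith

lemma IsCopula.sub_le_right {C : ℝ → ℝ → ℝ} (h : IsCopula C) {u v₁ v₂ : ℝ}
    (hu : u ∈ Icc (0 : ℝ) 1) (h₁ : v₁ ∈ Icc (0 : ℝ) 1) (h₂ : v₂ ∈ Icc (0 : ℝ) 1) (hv : v₁ ≤ v₂) :
    C u v₂ - C u v₁ ≤ v₂ - v₁ := by
  have := h.two_increasing u hu 1 (by simp) v₁ h₁ v₂ h₂ hu.2 hv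
  rw [h.one_left _ h₁, h.one_left _ h₂] at this
  linarith

lemma IsCopula.sub_le_left {C : ℝ → ℝ → ℝ} (h : IsCopula C) {u₁ u₂ v : ℝ}
    (h₁ : u₁ ∈ Icc (0 : ℝ) 1) (h₂ : u₂ ∈ Icc (0 : ℝ) 1) (hv : v ∈ Icc (0 : ℝ) 1) (hu : u₁ ≤ u₂) :
    C u₂ v - C u₁ v ≤ u₂ - u₁ := by
  have := h.two_increasing u₁ h₁ u₂ h₂ v hv 1 (by simp) hu hv.2
  rw [h.one_right _ h₁, h.one_right _ h₂] at this
  linarith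

/-- The one-sided form of the Lipschitz condition. -/
lemma IsCopula.sub_le {C : ℝ → ℝ → ℝ} (h : IsCopula C) {u₁ u₂ v₁ v₂ : ℝ}
    (hu₁ : u₁ ∈ Icc (0 : ℝ) 1) (hu₂ : u₂ ∈ Icc (0 : ℝ) 1)
    (hv₁ : v₁ ∈ Icc (0 : ℝ) 1) (hv₂ : v₂ ∈ Icc (0 : ℝ) 1) :
    C u₁ v₁ - C u₂ v₂ ≤ max 0 (u₁ - u₂) + max 0 (v₁ - v₂) := by
  have h1 : C u₁ v₁ - C u₂ v₁ ≤ max 0 (u₁ - u₂) := by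
    rcases le_total u₁ u₂ with hu | hu
    · exact le_max_of_le_left (sub_nonpos.2 (h.mono_left hu₁ hu₂ hv₁ hu))
    · exact le_max_of_le_right (h.sub_le_left hu₂ hu₁ hv₁ hu)
  have h2 : C u₂ v₁ - C u₂ v₂ ≤ max 0 (v₁ - v₂) := by
    rcases le_total v₁ v₂ with hv | hv
    · exact le_max_of_le_left (sub_nonpos.2 (h.mono_right hu₂ hv₁ hv₂ hv))
    · exact le_max_of_le_right (h.sub_le_right hu₂ hv₂ hv₁ hv)
  linarith

lemma IsCopula.isQuasiCopula {C : ℝ → ℝ → ℝ} (h : IsCopula C) : IsQuasiCopula C where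
  zero_left := h.zero_left
  zero_right := h.zero_right
  one_left := h.one_left
  one_right := h.one_right
  mono_left _ h₁ _ h₂ _ hv hu := h.mono_left h₁ h₂ hv hu
  mono_right _ hu _ h₁ _ h₂ hv := h.mono_right hu h₁ h₂ hv
  lipschitz u₁ hu₁ u₂ hu₂ v₁ hv₁ v₂ hv₂ := by
    have h1 := h.sub_le hu₁ hu₂ hv₁ hv₂
    have h2 := h.sub_le hu₂ hu₁ hv₂ hv₁
    have a1 : max 0 (u₁ - u₂) ≤ |u₁ - u₂| := max_le (abs_nonneg _) (le_abs_self _)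
    have a2 : max 0 (v₁ - v₂) ≤ |v₁ - v₂| := max_le (abs_nonneg _) (le_abs_self _)
    have a3 : max 0 (u₂ - u₁) ≤ |u₁ - u₂| :=
      max_le (abs_nonneg _) (by rw [abs_sub_comm]; exact le_abs_self _)
    have a4 : max 0 (v₂ - v₁) ≤ |v₁ - v₂| :=
      max_le (abs_nonneg _) (by rw [abs_sub_comm]; exact le_abs_self _)
    rw [abs_le]
    constructor <;> linarith

lemma IsQuasiCopula.le_M {Q : ℝ → ℝ → ℝ} (h : IsQuasiCopula Q) {u v : ℝ} (hu : u ∈ Icc (0 : ℝ) 1)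
    (hv : v ∈ Icc (0 : ℝ) 1) : Q u v ≤ M u v := by
  refine le_min ?_ ?_
  · exact (h.mono_right u hu v hv 1 (by simp) hv.2).trans_eq (h.one_right u hu)
  · exact (h.mono_left u hu 1 (by simp) v hv hu.2).trans_eq (h.one_left v hv)

lemma IsQuasiCopula.W_le {Q : ℝ → ℝ → ℝ} (h : IsQuasiCopula Q) {u v : ℝ} (hu : u ∈ Icc (0 : ℝ) 1)
    (hv : v ∈ Icc (0 : ℝ) 1) : W u v ≤ Q u v := by
  refine max_le ?_ ?_
  · rw [← h.zero_left v hv]; exact h.mono_left 0 (by simp) u hu v hv hu.1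
  · have := (abs_le.1 (h.lipschitz u hu 1 (by simp) v hv v hv)).1
    rw [h.one_left v hv, sub_self, abs_zero, abs_of_nonpos (by linarith [hu.2])] at this
    linarith

lemma IsQuasiCopula.continuousOn_comp {Q : ℝ → ℝ → ℝ} (h : IsQuasiCopula Q) {f g : ℝ → ℝ}
    {s : Set ℝ} (hf : ContinuousOn f s) (hg : ContinuousOn g s)
    (hfm : MapsTo f s (Icc 0 1)) (hgm : MapsTo g s (Icc 0 1)) :
    ContinuousOn (fun t => Q (f t) (g t)) s := by
  intro t ht
  have h0 : Filter.Tendsto (fun x => |f x - f t| + |g x - g t|) (nhdsWithin t s) (nhds 0) := by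
    have h1 := ((hf t ht).sub_const (f t)).abs
    have h2 := ((hg t ht).sub_const (g t)).abs
    simpa using h1.add h2
  rw [ContinuousWithinAt, tendsto_iff_dist_tendsto_zero]
  refine squeeze_zero' (Filter.Eventually.of_forall fun _ => dist_nonneg) ?_ h0
  filter_upwards [self_mem_nhdsWithin] with x hx
  exact h.lipschitz _ (hfm hx) _ (hfm ht) _ (hgm hx) _ (hgm ht)

lemma IsQuasiCopula.continuousOn_diag {Q : ℝ → ℝ → ℝ} (h : IsQuasiCopula Q) :
    ContinuousOn (fun t => Q t t) (Icc 0 1) :=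
  h.continuousOn_comp continuousOn_id continuousOn_id (fun _ h => h) (fun _ h => h)

lemma IsQuasiCopula.continuousOn_antidiag {Q : ℝ → ℝ → ℝ} (h : IsQuasiCopula Q) :
    ContinuousOn (fun t => Q t (1 - t)) (Icc 0 1) :=
  h.continuousOn_comp continuousOn_id (by fun_prop) (fun _ h => h)
    (fun t ht => ⟨by linarith [ht.2], by linarith [ht.1]⟩)

lemma IsQuasiCopula.intervalIntegrable_diag {Q : ℝ → ℝ → ℝ} (h : IsQuasiCopula Q) :
    IntervalIntegrable (fun t => Q t t) volume 0 1 :=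
  ContinuousOn.intervalIntegrable_of_Icc zero_le_one h.continuousOn_diag

lemma IsQuasiCopula.intervalIntegrable_antidiag {Q : ℝ → ℝ → ℝ} (h : IsQuasiCopula Q) :
    IntervalIntegrable (fun t => Q t (1 - t)) volume 0 1 :=
  ContinuousOn.intervalIntegrable_of_Icc zero_le_one h.continuousOn_antidiag

/-! ### Gini's gamma: monotonicity and mixtures -/

lemma IsQuasiCopula.gini_eq {Q : ℝ → ℝ → ℝ} (h : IsQuasiCopula Q) :
    gini Q = 4 * ((∫ t in (0 : ℝ)..1, Q t t) + ∫ t in (0 : ℝ)..1, Q t (1 - t)) - 2 := by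
  rw [gini, intervalIntegral.integral_add h.intervalIntegrable_diag h.intervalIntegrable_antidiag]

lemma gini_mono {P Q : ℝ → ℝ → ℝ} (hP : IsQuasiCopula P) (hQ : IsQuasiCopula Q)
    (h : ∀ u ∈ Icc (0 : ℝ) 1, ∀ v ∈ Icc (0 : ℝ) 1, P u v ≤ Q u v) : gini P ≤ gini Q := by
  have := intervalIntegral.integral_mono_on (zero_le_one' ℝ)
    (hP.intervalIntegrable_diag.add hP.intervalIntegrable_antidiag)
    (hQ.intervalIntegrable_diag.add hQ.intervalIntegrable_antidiag)
    (fun t ht => add_le_add (h t ht t ht)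
      (h t ht (1 - t) ⟨by linarith [ht.2], by linarith [ht.1]⟩))
  unfold gini
  linarith

lemma gini_lt_of_lt_diag {P Q : ℝ → ℝ → ℝ} (hP : IsQuasiCopula P) (hQ : IsQuasiCopula Q)
    (h : ∀ u ∈ Icc (0 : ℝ) 1, ∀ v ∈ Icc (0 : ℝ) 1, P u v ≤ Q u v) {t : ℝ} (ht : t ∈ Icc (0 : ℝ) 1)
    (hlt : P t t < Q t t) : gini P < gini Q := by
  have := intervalIntegral.integral_lt_integral_of_continuousOn_of_le_of_exists_lt
    (zero_lt_one' ℝ) (hP.continuousOn_diag.add hP.continuousOn_antidiag)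
    (hQ.continuousOn_diag.add hQ.continuousOn_antidiag)
    (fun t ht => add_le_add (h t (Ioc_subset_Icc_self ht) t (Ioc_subset_Icc_self ht))
      (h t (Ioc_subset_Icc_self ht) (1 - t) ⟨by linarith [ht.2], by linarith [ht.1]⟩))
    ⟨t, ht, add_lt_add_of_lt_of_le hlt
      (h t ht (1 - t) ⟨by linarith [ht.2], by linarith [ht.1]⟩)⟩
  simp only [Pi.add_apply] at this
  unfold gini
  linarith

lemma gini_lt_of_lt_antidiag {P Q : ℝ → ℝ → ℝ} (hP : IsQuasiCopula P) (hQ : IsQuasiCopula Q)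
    (h : ∀ u ∈ Icc (0 : ℝ) 1, ∀ v ∈ Icc (0 : ℝ) 1, P u v ≤ Q u v) {t : ℝ} (ht : t ∈ Icc (0 : ℝ) 1)
    (hlt : P t (1 - t) < Q t (1 - t)) : gini P < gini Q := by
  have := intervalIntegral.integral_lt_integral_of_continuousOn_of_le_of_exists_lt
    (zero_lt_one' ℝ) (hP.continuousOn_diag.add hP.continuousOn_antidiag)
    (hQ.continuousOn_diag.add hQ.continuousOn_antidiag)
    (fun t ht => add_le_add (h t (Ioc_subset_Icc_self ht) t (Ioc_subset_Icc_self ht))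
      (h t (Ioc_subset_Icc_self ht) (1 - t) ⟨by linarith [ht.2], by linarith [ht.1]⟩))
    ⟨t, ht, add_lt_add_of_le_of_lt (h t ht t ht) hlt⟩
  simp only [Pi.add_apply] at this
  unfold gini
  linarith

/-- Convex combinations of two functions on the square. -/
def mix (l : ℝ) (C D : ℝ → ℝ → ℝ) (u v : ℝ) : ℝ := (1 - l) * C u v + l * D u v

lemma IsCopula.mix {l : ℝ} (h0 : 0 ≤ l) (h1 : l ≤ 1) {C D : ℝ → ℝ → ℝ} (hC : IsCopula C)
    (hD : IsCopula D) : IsCopula (mix l C D) where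
  zero_left v hv := by simp [GiniBound.mix, hC.zero_left v hv, hD.zero_left v hv]
  zero_right v hv := by simp [GiniBound.mix, hC.zero_right v hv, hD.zero_right v hv]
  one_left v hv := by simp only [GiniBound.mix, hC.one_left v hv, hD.one_left v hv]; ring
  one_right v hv := by simp only [GiniBound.mix, hC.one_right v hv, hD.one_right v hv]; ring
  two_increasing u₁ hu₁ u₂ hu₂ v₁ hv₁ v₂ hv₂ hu hv := by
    have e1 := mul_nonneg (sub_nonneg.2 h1)
      (hC.two_increasing u₁ hu₁ u₂ hu₂ v₁ hv₁ v₂ hv₂ hu hv)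
    have e2 := mul_nonneg h0 (hD.two_increasing u₁ hu₁ u₂ hu₂ v₁ hv₁ v₂ hv₂ hu hv)
    simp only [GiniBound.mix]
    linarith

lemma gini_mix {l : ℝ} {C D : ℝ → ℝ → ℝ} (hC : IsQuasiCopula C) (hD : IsQuasiCopula D) :
    gini (mix l C D) = (1 - l) * gini C + l * gini D := by
  have : ∀ t : ℝ, mix l C D t t + mix l C D t (1 - t) =
      (1 - l) * (C t t + C t (1 - t)) + l * (D t t + D t (1 - t)) := by
    intro t; simp only [mix]; ring
  simp only [gini, this]
  rw [intervalIntegral.integral_add, intervalIntegral.integral_const_mul,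
    intervalIntegral.integral_const_mul]
  · ring
  · exact (hC.intervalIntegrable_diag.add hC.intervalIntegrable_antidiag).const_mul _
  · exact (hD.intervalIntegrable_diag.add hD.intervalIntegrable_antidiag).const_mul _

/-- Every intermediate value of Gini's gamma is taken on the segment between two copulas. -/
lemma exists_mix {C D : ℝ → ℝ → ℝ} (hC : IsCopula C) (hD : IsCopula D) {γ : ℝ}
    (h₁ : gini C ≤ γ) (h₂ : γ ≤ gini D) :
    ∃ l : ℝ, 0 ≤ l ∧ l ≤ 1 ∧ mix l C D ∈ giniClass γ := by
  rcases eq_or_lt_of_le (h₁.trans h₂) with h | h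
  · refine ⟨0, le_rfl, zero_le_one, hC.mix le_rfl zero_le_one hD, ?_⟩
    rw [gini_mix hC.isQuasiCopula hD.isQuasiCopula]
    linarith
  · have hp : 0 < gini D - gini C := sub_pos.2 h
    have i0 : 0 ≤ (γ - gini C) / (gini D - gini C) := div_nonneg (by linarith) hp.le
    have i1 : (γ - gini C) / (gini D - gini C) ≤ 1 := (div_le_one hp).2 (by linarith)
    refine ⟨_, i0, i1, hC.mix i0 i1 hD, ?_⟩
    rw [gini_mix hC.isQuasiCopula hD.isQuasiCopula]
    field_simp
    ring

/-! ### The extremal copulas -/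

lemma isCopula_M : IsCopula M where
  zero_left v hv := min_eq_left hv.1
  zero_right u hu := min_eq_right hu.1
  one_left v hv := min_eq_right hv.2
  one_right u hu := min_eq_left hu.2
  two_increasing u₁ _ u₂ _ v₁ _ v₂ _ hu hv := by
    simp only [M, min_def]
    split_ifs <;> linarith

/-- Convexity of `max p ·`: a convex function of a sum has nonnegative mixed differences. -/
lemma max_add_two_increasing (p : ℝ) {u₁ u₂ w₁ w₂ : ℝ} (hu : u₁ ≤ u₂) (hw : w₁ ≤ w₂) :
    0 ≤ max p (u₂ + w₂) - max p (u₁ + w₂) - max p (u₂ + w₁) + max p (u₁ + w₁) := by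
  simp only [max_def]
  split_ifs <;> linarith

/-- The smallest copula with value `d` at `(a, b)`. -/
def minCopula (a b d u v : ℝ) : ℝ := max (W u v) (d - max 0 (a - u) - max 0 (b - v))

lemma minCopula_comm (a b d u v : ℝ) : minCopula a b d u v = minCopula b a d v u := by
  simp only [minCopula, W, add_comm u v]
  congr 1
  ring

lemma minCopula_self {a b d : ℝ} (hd : W a b ≤ d) : minCopula a b d a b = d := by
  simp [minCopula, hd]

/-- To the left of `a` the function has the form `max 0 (u + w v)` with `w` nondecreasing, to which
`max_add_two_increasing` applies. -/
lemma minCopula_of_le {a u : ℝ} (hu : u ≤ a) (b d v : ℝ) :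
    minCopula a b d u v = max 0 (u + max (v - 1) (d - a - max 0 (b - v))) := by
  rw [minCopula, W, max_assoc, ← max_add_add_left, max_eq_right (sub_nonneg.2 hu)]
  congr 2 <;> ring

lemma minCopula_of_ge {a b d u v : ℝ} (h : 0 ≤ d) (hu : a ≤ u) (hv : b ≤ v) :
    minCopula a b d u v = max d (u + (v - 1)) := by
  rw [minCopula, W, max_eq_left (sub_nonpos.2 hu), max_eq_left (sub_nonpos.2 hv), sub_zero,
    sub_zero, max_right_comm, max_eq_right h, add_sub_assoc]

lemma isCopula_minCopula {a b d : ℝ} (ha : a ∈ Icc (0 : ℝ) 1) (hb : b ∈ Icc (0 : ℝ) 1)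
    (h₁ : W a b ≤ d) (h₂ : d ≤ M a b) : IsCopula (minCopula a b d) := by
  have hd0 : 0 ≤ d := (le_max_left _ _).trans h₁
  have hds : a + b - 1 ≤ d := (le_max_right _ _).trans h₁
  have hda : d ≤ a := h₂.trans (min_le_left _ _)
  have hdb : d ≤ b := h₂.trans (min_le_right _ _)
  -- Volumes add when a rectangle is cut along `u = a` and `v = b`, so each side of the cuts is
  -- treated separately. The names `a` and `b` are rebound here so that the same fact, with
  -- coordinates exchanged, covers the part below `b`.
  have left : ∀ {a b u₁ u₂ v₁ v₂ : ℝ}, u₁ ≤ u₂ → v₁ ≤ v₂ → u₂ ≤ a →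
      0 ≤ minCopula a b d u₂ v₂ - minCopula a b d u₁ v₂ - minCopula a b d u₂ v₁
        + minCopula a b d u₁ v₁ := by
    intro a b u₁ u₂ v₁ v₂ hu hv hua
    simp only [minCopula_of_le hua, minCopula_of_le (hu.trans hua)]
    exact max_add_two_increasing _ hu (max_le_max (by linarith)
      (sub_le_sub_left (max_le_max le_rfl (by linarith)) _))
  have right : ∀ {u₁ u₂ v₁ v₂ : ℝ}, u₁ ≤ u₂ → v₁ ≤ v₂ → a ≤ u₁ →
      0 ≤ minCopula a b d u₂ v₂ - minCopula a b d u₁ v₂ - minCopula a b d u₂ v₁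
        + minCopula a b d u₁ v₁ := by
    intro u₁ u₂ v₁ v₂ hu hv hua
    have below : ∀ {v₁ v₂ : ℝ}, v₁ ≤ v₂ → v₂ ≤ b →
        0 ≤ minCopula a b d u₂ v₂ - minCopula a b d u₁ v₂ - minCopula a b d u₂ v₁
          + minCopula a b d u₁ v₁ := by
      intro v₁ v₂ hv hvb
      have := left (b := a) hv hu hvb
      simp only [minCopula_comm b a d] at this
      linarith
    have above : ∀ {v₁ v₂ : ℝ}, v₁ ≤ v₂ → b ≤ v₁ →
        0 ≤ minCopula a b d u₂ v₂ - minCopula a b d u₁ v₂ - minCopula a b d u₂ v₁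
          + minCopula a b d u₁ v₁ := by
      intro v₁ v₂ hv hvb
      simp only [minCopula_of_ge hd0 hua hvb, minCopula_of_ge hd0 hua (hvb.trans hv),
        minCopula_of_ge hd0 (hua.trans hu) hvb, minCopula_of_ge hd0 (hua.trans hu) (hvb.trans hv)]
      exact max_add_two_increasing _ hu (by linarith)
    rcases le_total v₂ b with h | h
    · exact below hv h
    rcases le_total b v₁ with h' | h'
    · exact above hv h'
    linarith [below h' le_rfl, above h le_rfl]
  refine ⟨?_, ?_, ?_, ?_, ?_⟩
  · intro v hv
    have := hv.1; have := hv.2; have := ha.1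
    simp only [minCopula, W, max_def]
    split_ifs <;> linarith
  · intro v hv
    have := hv.1; have := hv.2; have := hb.1
    simp only [minCopula, W, max_def]
    split_ifs <;> linarith
  · intro v hv
    have := hv.1; have := hv.2; have := ha.2
    simp only [minCopula, W, max_def]
    split_ifs <;> linarith
  · intro v hv
    have := hv.1; have := hv.2; have := hb.2
    simp only [minCopula, W, max_def]
    split_ifs <;> linarith
  · intro u₁ _ u₂ _ v₁ _ v₂ _ hu hv
    rcases le_total u₂ a with h | h
    · exact left hu hv h
    rcases le_total a u₁ with h' | h'
    · exact right hu hv h'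
    linarith [left (b := b) h' hv le_rfl, right h hv le_rfl]

lemma IsCopula.minCopula_le {C : ℝ → ℝ → ℝ} (hC : IsCopula C) {a b u v : ℝ}
    (ha : a ∈ Icc (0 : ℝ) 1) (hb : b ∈ Icc (0 : ℝ) 1) (hu : u ∈ Icc (0 : ℝ) 1)
    (hv : v ∈ Icc (0 : ℝ) 1) : minCopula a b (C a b) u v ≤ C u v :=
  max_le (hC.isQuasiCopula.W_le hu hv) (by linarith [hC.sub_le ha hu hb hv])

lemma W_eq_minCopula : W = minCopula 0 0 0 := by
  ext u v
  simp only [minCopula, W]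
  exact (max_eq_left (le_max_of_le_left
    (by linarith [le_max_left 0 (0 - u), le_max_left 0 (0 - v)]))).symm

lemma isCopula_W : IsCopula W := by
  rw [W_eq_minCopula]
  exact isCopula_minCopula (by simp) (by simp) (by simp [W]) (by simp [M])

/-! ### Gini's gamma of the extremal copulas -/

lemma integral_max_zero_sub {p : ℝ} (h0 : 0 ≤ p) (h1 : p ≤ 1) :
    ∫ t in (0 : ℝ)..1, max 0 (t - p) = (1 - p) ^ 2 / 2 := by
  have hc : Continuous fun t : ℝ => max 0 (t - p) := by fun_prop
  rw [← intervalIntegral.integral_add_adjacent_intervals (hc.intervalIntegrable 0 p)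
    (hc.intervalIntegrable p 1)]
  have e1 : ∫ t in (0 : ℝ)..p, max 0 (t - p) = ∫ t in (0 : ℝ)..p, (0 : ℝ) := by
    refine intervalIntegral.integral_congr fun t ht => ?_
    rw [uIcc_of_le h0] at ht
    exact max_eq_left (by linarith [ht.2])
  have e2 : ∫ t in p..1, max 0 (t - p) = ∫ t in p..1, (t - p) := by
    refine intervalIntegral.integral_congr fun t ht => ?_
    rw [uIcc_of_le h1] at ht
    exact max_eq_right (by linarith [ht.1])
  rw [e1, e2, intervalIntegral.integral_sub (by simp) (by simp)]
  simp only [intervalIntegral.integral_zero, integral_id, intervalIntegral.integral_const,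
    smul_eq_mul]
  ring

lemma max_zero_sub_comm (x y : ℝ) : max 0 (x - y) = max 0 (y - x) + (x - y) := by
  rw [← max_add_add_right, zero_add, sub_add_sub_cancel, sub_self, max_comm]

/-- The two hypotheses say that the kinks occur in the order `(a + b - d)/2`, then `a` and `b`, then
`(1 + d)/2`. The section is then a fixed combination of hinge functions, each integrated by
`integral_max_zero_sub`. -/
lemma minCopula_diag {a b d t : ℝ} (h₁ : |a - b| ≤ d) (h₂ : |a - b| ≤ d - (a + b - 1)) :
    minCopula a b d t t = 2 * max 0 (t - (a + b - d) / 2) - max 0 (t - a) - max 0 (t - b)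
        + 2 * max 0 (t - (1 + d) / 2) := by
  obtain ⟨h11, h12⟩ := abs_le.1 h₁
  obtain ⟨h21, h22⟩ := abs_le.1 h₂
  rw [minCopula, W, max_zero_sub_comm t a, max_zero_sub_comm t b]
  rcases le_total t a with h | h <;> rcases le_total t b with h' | h' <;>
    simp only [max_eq_left, max_eq_right, sub_nonneg, sub_nonpos, h, h'] <;>
    rcases le_total t ((a + b - d) / 2) with k | k <;>
    rcases le_total t ((1 + d) / 2) with k' | k' <;>
    simp only [max_eq_left, max_eq_right, sub_nonneg, sub_nonpos, k, k'] <;>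
    rcases le_total 0 (t + t - 1) with l | l <;>
    simp only [max_eq_left, max_eq_right, l] <;>
    first
    | (rw [max_eq_left (by linarith)]; linarith)
    | (rw [max_eq_right (by linarith)]; linarith)

lemma minCopula_antidiag {a b d t : ℝ} (hd : 0 ≤ d) (h : a + b - 1 ≤ d) :
    minCopula a b d t (1 - t) =
      max 0 (t - (a - d)) - max 0 (t - a) - max 0 (t - (1 - b)) + max 0 (t - (1 - b + d)) := by
  rw [minCopula, W, max_zero_sub_comm t a, show b - (1 - t) = t - (1 - b) by ring,
    show t + (1 - t) - 1 = 0 by ring, max_self]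
  rcases le_total t a with h | h <;> rcases le_total t (1 - b) with h' | h' <;>
    simp only [max_eq_left, max_eq_right, sub_nonneg, sub_nonpos, h, h'] <;>
    rcases le_total t (a - d) with k | k <;>
    rcases le_total t (1 - b + d) with k' | k' <;>
    simp only [max_eq_left, max_eq_right, sub_nonneg, sub_nonpos, k, k'] <;>
    first
    | (rw [max_eq_left (by linarith)]; linarith)
    | (rw [max_eq_right (by linarith)]; linarith)

lemma gini_minCopula {a b d : ℝ} (ha : a ∈ Icc (0 : ℝ) 1) (hb : b ∈ Icc (0 : ℝ) 1)
    (hda : d ≤ a) (hdb : d ≤ b) (h₁ : |a - b| ≤ d) (h₂ : |a - b| ≤ d - (a + b - 1)) :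
    gini (minCopula a b d) = 6 * (d * (d - (a + b - 1))) - (a - b) ^ 2 - 1 := by
  have ha0 := ha.1; have ha1 := ha.2; have hb0 := hb.1; have hb1 := hb.2
  have h11 := (abs_le.1 h₁).1; have h12 := (abs_le.1 h₁).2
  have h21 := (abs_le.1 h₂).1; have h22 := (abs_le.1 h₂).2
  have e : ∀ t ∈ uIcc (0 : ℝ) 1, minCopula a b d t t + minCopula a b d t (1 - t) =
      (2 * max 0 (t - (a + b - d) / 2) - max 0 (t - a) - max 0 (t - b)
        + 2 * max 0 (t - (1 + d) / 2)) +
      (max 0 (t - (a - d)) - max 0 (t - a) - max 0 (t - (1 - b)) + max 0 (t - (1 - b + d))) := by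
    intro t ht
    rw [minCopula_diag h₁ h₂, minCopula_antidiag (by linarith) (by linarith)]
  rw [gini, intervalIntegral.integral_congr e, intervalIntegral.integral_add,
    intervalIntegral.integral_add, intervalIntegral.integral_sub, intervalIntegral.integral_sub,
    intervalIntegral.integral_add, intervalIntegral.integral_sub, intervalIntegral.integral_sub,
    intervalIntegral.integral_const_mul, intervalIntegral.integral_const_mul]
  · repeat rw [integral_max_zero_sub (by linarith) (by linarith)]
    ring
  all_goals exact Continuous.intervalIntegrable (by fun_prop) _ _

lemma gini_M : gini M = 1 := by
  have : EqOn (fun t : ℝ => M t t + M t (1 - t))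
      (fun t => t + (max 0 (t - 0) - 2 * max 0 (t - 1 / 2))) (uIcc (0 : ℝ) 1) := by
    intro t ht
    rw [uIcc_of_le zero_le_one] at ht
    have := ht.1; have := ht.2
    simp only [M, max_def, min_def]
    split_ifs <;> linarith
  rw [gini, intervalIntegral.integral_congr this, intervalIntegral.integral_add,
    intervalIntegral.integral_sub, intervalIntegral.integral_const_mul,
    integral_max_zero_sub (by norm_num) (by norm_num),
    integral_max_zero_sub (by norm_num) (by norm_num), integral_id]
  · norm_num
  all_goals exact Continuous.intervalIntegrable (by fun_prop) _ _

lemma gini_W : gini W = -1 := by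
  rw [W_eq_minCopula, gini_minCopula] <;> norm_num

lemma gini_mem_Icc {C : ℝ → ℝ → ℝ} (hC : IsCopula C) : gini C ∈ Icc (-1 : ℝ) 1 := by
  have h1 := gini_mono isCopula_W.isQuasiCopula hC.isQuasiCopula
    fun u hu v hv => hC.isQuasiCopula.W_le hu hv
  have h2 := gini_mono hC.isQuasiCopula isCopula_M.isQuasiCopula
    fun u hu v hv => hC.isQuasiCopula.le_M hu hv
  rw [gini_W] at h1
  rw [gini_M] at h2
  exact ⟨h1, h2⟩

lemma gini_minCopula_le {C : ℝ → ℝ → ℝ} (hC : IsCopula C) {a b : ℝ}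
    (ha : a ∈ Icc (0 : ℝ) 1) (hb : b ∈ Icc (0 : ℝ) 1) :
    gini (minCopula a b (C a b)) ≤ gini C :=
  gini_mono (isCopula_minCopula ha hb (hC.isQuasiCopula.W_le ha hb)
      (hC.isQuasiCopula.le_M ha hb)).isQuasiCopula hC.isQuasiCopula
    fun _ hu _ hv => hC.minCopula_le ha hb hu hv


/-! ### The pointwise supremum: quasi-copula property, order and symmetries -/

lemma one_sub_mem_Icc {u : ℝ} (hu : u ∈ Icc (0 : ℝ) 1) : 1 - u ∈ Icc (0 : ℝ) 1 :=
  ⟨by linarith [hu.2], by linarith [hu.1]⟩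

lemma survival_apply (C : ℝ → ℝ → ℝ) (u v : ℝ) :
    survival C u v = u + v - 1 + C (1 - u) (1 - v) := by
  simp only [survival, reflectSnd, reflectFst]
  ring

lemma bddAbove_values (γ : ℝ) {a b : ℝ} (ha : a ∈ Icc (0 : ℝ) 1) (hb : b ∈ Icc (0 : ℝ) 1) :
    BddAbove ((fun C : ℝ → ℝ → ℝ => C a b) '' giniClass γ) :=
  ⟨M a b, by rintro _ ⟨C, hC, rfl⟩; exact hC.1.isQuasiCopula.le_M ha hb⟩

lemma giniClass_nonempty {γ : ℝ} (hγ : γ ∈ Icc (-1 : ℝ) 1) : (giniClass γ).Nonempty := by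
  obtain ⟨l, -, -, h⟩ := exists_mix isCopula_W isCopula_M (gini_W.trans_le hγ.1)
    (hγ.2.trans_eq gini_M.symm)
  exact ⟨_, h⟩

lemma le_upperBound {γ a b : ℝ} {C : ℝ → ℝ → ℝ} (hC : C ∈ giniClass γ) (ha : a ∈ Icc (0 : ℝ) 1)
    (hb : b ∈ Icc (0 : ℝ) 1) : C a b ≤ upperBound γ a b :=
  le_csSup (bddAbove_values γ ha hb) (mem_image_of_mem _ hC)

lemma upperBound_le {γ a b x : ℝ} (hγ : γ ∈ Icc (-1 : ℝ) 1)
    (h : ∀ C ∈ giniClass γ, C a b ≤ x) : upperBound γ a b ≤ x :=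
  csSup_le ((giniClass_nonempty hγ).image _) (by rintro _ ⟨C, hC, rfl⟩; exact h C hC)

lemma upperBound_eq {γ a b x : ℝ} (hγ : γ ∈ Icc (-1 : ℝ) 1)
    (h : ∀ C ∈ giniClass γ, C a b = x) : upperBound γ a b = x := by
  have : (fun C : ℝ → ℝ → ℝ => C a b) '' giniClass γ = {x} := by
    refine (subset_singleton_iff.2 ?_).antisymm (singleton_subset_iff.2 ?_)
    · rintro _ ⟨C, hC, rfl⟩; exact h C hC
    · obtain ⟨C, hC⟩ := giniClass_nonempty hγ
      exact ⟨C, hC, h C hC⟩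
  rw [upperBound, this, csSup_singleton]

lemma isQuasiCopula_upperBound {γ : ℝ} (hγ : γ ∈ Icc (-1 : ℝ) 1) :
    IsQuasiCopula (upperBound γ) where
  zero_left v hv := upperBound_eq hγ fun _ hC => hC.1.zero_left v hv
  zero_right u hu := upperBound_eq hγ fun _ hC => hC.1.zero_right u hu
  one_left v hv := upperBound_eq hγ fun _ hC => hC.1.one_left v hv
  one_right u hu := upperBound_eq hγ fun _ hC => hC.1.one_right u hu
  mono_left _ h₁ _ h₂ _ hv hu := upperBound_le hγ fun _ hC =>
    (hC.1.mono_left h₁ h₂ hv hu).trans (le_upperBound hC h₂ hv)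
  mono_right _ hu _ h₁ _ h₂ hv := upperBound_le hγ fun _ hC =>
    (hC.1.mono_right hu h₁ h₂ hv).trans (le_upperBound hC hu h₂)
  lipschitz u₁ hu₁ u₂ hu₂ v₁ hv₁ v₂ hv₂ := by
    rw [abs_sub_le_iff]
    constructor
    · rw [sub_le_iff_le_add]
      refine upperBound_le hγ fun C hC => ?_
      have := (abs_sub_le_iff.1 (hC.1.isQuasiCopula.lipschitz u₁ hu₁ u₂ hu₂ v₁ hv₁ v₂ hv₂)).1
      linarith [le_upperBound hC hu₂ hv₂]
    · rw [sub_le_iff_le_add]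
      refine upperBound_le hγ fun C hC => ?_
      have := (abs_sub_le_iff.1 (hC.1.isQuasiCopula.lipschitz u₁ hu₁ u₂ hu₂ v₁ hv₁ v₂ hv₂)).2
      linarith [le_upperBound hC hu₁ hv₁]

/-- A copula whose Gini's gamma does not exceed the parameter lies below the bound. -/
lemma le_upperBound_of_gini_le {γ a b : ℝ} (hγ : γ ≤ 1) {C : ℝ → ℝ → ℝ} (hC : IsCopula C)
    (h : gini C ≤ γ) (ha : a ∈ Icc (0 : ℝ) 1) (hb : b ∈ Icc (0 : ℝ) 1) :
    C a b ≤ upperBound γ a b := by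
  obtain ⟨l, h0, h1, hl⟩ := exists_mix hC isCopula_M h (hγ.trans_eq gini_M.symm)
  refine le_trans ?_ (le_upperBound hl ha hb)
  have := hC.isQuasiCopula.le_M ha hb
  simp only [mix]
  nlinarith

lemma upperBound_mono {γ γ' : ℝ} (hγ : γ ∈ Icc (-1 : ℝ) 1) (hγ' : γ' ≤ 1) (h : γ ≤ γ') {a b : ℝ}
    (ha : a ∈ Icc (0 : ℝ) 1) (hb : b ∈ Icc (0 : ℝ) 1) : upperBound γ a b ≤ upperBound γ' a b :=
  upperBound_le hγ fun _ hC => le_upperBound_of_gini_le hγ' hC.1 (hC.2.trans_le h) ha hb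

lemma IsCopula.transpose {C : ℝ → ℝ → ℝ} (hC : IsCopula C) : IsCopula fun u v => C v u where
  zero_left := hC.zero_right
  zero_right := hC.zero_left
  one_left := hC.one_right
  one_right := hC.one_left
  two_increasing u₁ hu₁ u₂ hu₂ v₁ hv₁ v₂ hv₂ hu hv := by
    linarith [hC.two_increasing v₁ hv₁ v₂ hv₂ u₁ hu₁ u₂ hu₂ hv hu]

lemma integral_comp_one_sub (f : ℝ → ℝ) :
    ∫ t in (0 : ℝ)..1, f (1 - t) = ∫ t in (0 : ℝ)..1, f t := by
  simp

lemma gini_transpose {C : ℝ → ℝ → ℝ} (hC : IsCopula C) : gini (fun u v => C v u) = gini C := by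
  rw [hC.transpose.isQuasiCopula.gini_eq, hC.isQuasiCopula.gini_eq,
    ← integral_comp_one_sub fun t => C t (1 - t)]
  simp only [sub_sub_cancel]

lemma IsCopula.survival {C : ℝ → ℝ → ℝ} (hC : IsCopula C) : IsCopula (survival C) where
  zero_left v hv := by
    rw [survival_apply, sub_zero, hC.one_left _ (one_sub_mem_Icc hv)]; ring
  zero_right v hv := by
    rw [survival_apply, sub_zero, hC.one_right _ (one_sub_mem_Icc hv)]; ring
  one_left v hv := by
    rw [survival_apply, sub_self, hC.zero_left _ (one_sub_mem_Icc hv)]; ring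
  one_right v hv := by
    rw [survival_apply, sub_self, hC.zero_right _ (one_sub_mem_Icc hv)]; ring
  two_increasing u₁ hu₁ u₂ hu₂ v₁ hv₁ v₂ hv₂ hu hv := by
    simp only [survival_apply]
    linarith [hC.two_increasing _ (one_sub_mem_Icc hu₂) _ (one_sub_mem_Icc hu₁) _
      (one_sub_mem_Icc hv₂) _ (one_sub_mem_Icc hv₁) (by linarith) (by linarith)]

lemma gini_survival {C : ℝ → ℝ → ℝ} (hC : IsCopula C) : gini (survival C) = gini C := by
  have e1 : ∫ t in (0 : ℝ)..1, survival C t t = ∫ t in (0 : ℝ)..1, C t t := by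
    rw [← integral_comp_one_sub fun t => C t t]
    simp only [survival_apply]
    rw [intervalIntegral.integral_add]
    · norm_num
    · exact Continuous.intervalIntegrable (by fun_prop) _ _
    · exact ContinuousOn.intervalIntegrable_of_Icc zero_le_one
        (hC.isQuasiCopula.continuousOn_comp (by fun_prop) (by fun_prop)
          (fun _ h => one_sub_mem_Icc h) (fun _ h => one_sub_mem_Icc h))
  have e2 : ∫ t in (0 : ℝ)..1, survival C t (1 - t) = ∫ t in (0 : ℝ)..1, C t (1 - t) := by
    rw [← integral_comp_one_sub fun t => C t (1 - t)]
    simp [survival_apply]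
  rw [hC.survival.isQuasiCopula.gini_eq, hC.isQuasiCopula.gini_eq, e1, e2]

lemma isSymmetric_upperBound {γ : ℝ} (hγ : γ ∈ Icc (-1 : ℝ) 1) : IsSymmetric (upperBound γ) := by
  have key : ∀ u ∈ Icc (0 : ℝ) 1, ∀ v ∈ Icc (0 : ℝ) 1, upperBound γ u v ≤ upperBound γ v u :=
    fun u hu v hv => upperBound_le hγ fun C hC =>
      le_upperBound (C := fun u v => C v u) ⟨hC.1.transpose, (gini_transpose hC.1).trans hC.2⟩ hv hu
  exact fun u hu v hv => (key u hu v hv).antisymm (key v hv u hu)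

lemma isRadiallySymmetric_upperBound {γ : ℝ} (hγ : γ ∈ Icc (-1 : ℝ) 1) :
    IsRadiallySymmetric (upperBound γ) := by
  have key : ∀ u ∈ Icc (0 : ℝ) 1, ∀ v ∈ Icc (0 : ℝ) 1,
      upperBound γ (1 - u) (1 - v) ≤ 1 - u - v + upperBound γ u v := by
    refine fun u hu v hv => upperBound_le hγ fun C hC => ?_
    have := le_upperBound (C := survival C) ⟨hC.1.survival, (gini_survival hC.1).trans hC.2⟩ hu hv
    rw [survival_apply] at this
    linarith
  intro u hu v hv
  rw [survival_apply]
  have h1 := key u hu v hv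
  have h2 := key _ (one_sub_mem_Icc hu) _ (one_sub_mem_Icc hv)
  simp only [sub_sub_cancel] at h2
  linarith

lemma concordanceLE_upperBound {γ γ' : ℝ} (hγ : γ ∈ Icc (-1 : ℝ) 1) (hγ' : γ' ∈ Icc (-1 : ℝ) 1)
    (h : γ ≤ γ') : ConcordanceLE (upperBound γ) (upperBound γ') := by
  intro u hu v hv
  have := upperBound_mono hγ hγ'.2 h hu hv
  refine ⟨this, ?_⟩
  rwa [← isRadiallySymmetric_upperBound hγ u hu v hv, ← isRadiallySymmetric_upperBound hγ' u hu v hv]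

/-- Since `C` dominates `W` and both sections are continuous, equality of gamma forces `C` to vanish
on the antidiagonal. Monotonicity below it and the Lipschitz bound above it then give `C ≤ W`. -/
lemma eq_W_of_gini_eq_neg_one {C : ℝ → ℝ → ℝ} (hC : IsCopula C) (h : gini C = -1) :
    EqOnSquare C W := by
  have hanti : ∀ t ∈ Icc (0 : ℝ) 1, C t (1 - t) = 0 := by
    intro t ht
    have hW : W t (1 - t) = 0 := by simp [W]
    have h0 := hC.isQuasiCopula.W_le ht (one_sub_mem_Icc ht)
    refine le_antisymm (not_lt.1 fun hlt => ?_) (hW ▸ h0)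
    have := gini_lt_of_lt_antidiag isCopula_W.isQuasiCopula hC.isQuasiCopula
      (fun u hu v hv => hC.isQuasiCopula.W_le hu hv) ht (hW.trans_lt hlt)
    rw [gini_W, h] at this
    exact lt_irrefl _ this
  intro u hu v hv
  refine le_antisymm ?_ (hC.isQuasiCopula.W_le hu hv)
  rcases le_total v (1 - u) with huv | huv
  · exact ((hC.mono_right hu hv (one_sub_mem_Icc hu) huv).trans_eq (hanti u hu)).trans
      (le_max_left _ _)
  · have := hC.sub_le_right hu (one_sub_mem_Icc hu) hv huv
    rw [hanti u hu] at this
    exact le_max_of_le_right (by linarith)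

lemma upperBound_neg_one : EqOnSquare (upperBound (-1)) W := fun u hu v hv =>
  upperBound_eq (by norm_num) fun _ hC => eq_W_of_gini_eq_neg_one hC.1 hC.2 u hu v hv

/-- The bound dominates both copulas, hence strictly exceeds `C` at `(t, t)`, and `gini C = γ`. -/
lemma lt_gini_of_diag_ne {γ : ℝ} {C D : ℝ → ℝ → ℝ} (hC : C ∈ giniClass γ) (hD : D ∈ giniClass γ)
    {t : ℝ} (ht : t ∈ Icc (0 : ℝ) 1) (hne : C t t < D t t) : γ < gini (upperBound γ) := by
  have hγ : γ ∈ Icc (-1 : ℝ) 1 := hC.2 ▸ gini_mem_Icc hC.1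
  have := gini_lt_of_lt_diag hC.1.isQuasiCopula (isQuasiCopula_upperBound hγ)
    (fun u hu v hv => le_upperBound hC hu hv) ht (hne.trans_le (le_upperBound hD ht ht))
  rwa [hC.2] at this

lemma lt_gini_upperBound {γ : ℝ} (hγ : γ ∈ Ioo (-1 : ℝ) 1) : γ < gini (upperBound γ) := by
  -- This third copula agrees with `W` at `(1/4, 1/4)` and with `M` at `(1/2, 1/2)`. Mixing it with
  -- `W` or with `M`, according to its gamma, gives a member of the class differing on the diagonal
  -- from the mixture of `W` and `M`.
  have hE : IsCopula (minCopula (1 / 2) (1 / 2) (1 / 2)) :=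
    isCopula_minCopula (by norm_num) (by norm_num) (by norm_num [W]) (by norm_num [M])
  have hq : (1 / 4 : ℝ) ∈ Icc (0 : ℝ) 1 := by norm_num
  have hh : (1 / 2 : ℝ) ∈ Icc (0 : ℝ) 1 := by norm_num
  have E4 : minCopula (1 / 2) (1 / 2) (1 / 2) (1 / 4) (1 / 4) = 0 := by norm_num [minCopula, W]
  have E2 : minCopula (1 / 2) (1 / 2) (1 / 2) (1 / 2) (1 / 2) = 1 / 2 := by
    norm_num [minCopula, W]
  obtain ⟨l, hl0, hl1, hl⟩ := exists_mix isCopula_W isCopula_M (gini_W.trans_le hγ.1.le)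
    (hγ.2.le.trans_eq gini_M.symm)
  have hlg := hl.2
  rw [gini_mix isCopula_W.isQuasiCopula isCopula_M.isQuasiCopula, gini_W, gini_M] at hlg
  have := hγ.1; have := hγ.2
  rcases le_total γ (gini (minCopula (1 / 2) (1 / 2) (1 / 2))) with h | h
  · obtain ⟨m, -, -, hm⟩ := exists_mix isCopula_W hE (gini_W.trans_le hγ.1.le) h
    refine lt_gini_of_diag_ne hm hl hq ?_
    rw [mix, mix, E4]
    norm_num [W, M]
    linarith
  · obtain ⟨m, -, -, hm⟩ := exists_mix hE isCopula_M h (hγ.2.le.trans_eq gini_M.symm)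
    refine lt_gini_of_diag_ne hl hm hh ?_
    rw [mix, mix, E2]
    norm_num [W, M]
    linarith


/-! ### The explicit form of the bound -/

/-- The radicand of `omega`, up to a factor. -/
def radicand (γ a b : ℝ) : ℝ := (a + b - 1) ^ 2 + 2 / 3 * ((a - b) ^ 2 + 1 + γ)

lemma omega_eq (γ a b : ℝ) : omega γ a b = (a + b - 1) / 2 + √(radicand γ a b) / 2 := by
  have : 5 * (a + b - 1) ^ 2 - 2 * (1 - 2 * a) * (1 - 2 * b) + 2 * (1 + γ) =
      3 * radicand γ a b := by unfold radicand; ring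
  rw [omega, this, Real.sqrt_mul (by norm_num)]
  linear_combination √(radicand γ a b) / 6 * Real.mul_self_sqrt (show (0 : ℝ) ≤ 3 by norm_num)

lemma radicand_pos {γ : ℝ} (hγ : -1 < γ) (a b : ℝ) : 0 < radicand γ a b := by
  have := sq_nonneg (a + b - 1)
  have := sq_nonneg (a - b)
  unfold radicand
  linarith

lemma omega_comm (γ a b : ℝ) : omega γ a b = omega γ b a := by
  rw [omega_eq, omega_eq, radicand, radicand, add_comm a b, ← neg_sub a b, neg_sq]

/-- The quadratic equation behind `omega`: by `gini_minCopula` it says that the smallest copula with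
value `omega γ a b` at `(a, b)` has gamma `γ`, where that formula is valid. -/
lemma omega_mul {γ : ℝ} (hγ : -1 < γ) (a b : ℝ) :
    6 * (omega γ a b * (omega γ a b - (a + b - 1))) = (a - b) ^ 2 + 1 + γ := by
  have h := Real.mul_self_sqrt (radicand_pos hγ a b).le
  rw [omega_eq]
  nth_rw 3 [radicand] at h
  linear_combination 3 / 2 * h

lemma abs_lt_sqrt_radicand {γ : ℝ} (hγ : -1 < γ) (a b : ℝ) :
    |a + b - 1| < √(radicand γ a b) := by
  apply Real.lt_sqrt_of_sq_lt
  have := sq_nonneg (a - b)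
  rw [sq_abs, radicand]
  linarith

lemma omega_pos {γ : ℝ} (hγ : -1 < γ) (a b : ℝ) : 0 < omega γ a b := by
  rw [omega_eq]
  linarith [abs_lt_sqrt_radicand hγ a b, neg_abs_le (a + b - 1)]

lemma lt_omega {γ : ℝ} (hγ : -1 < γ) (a b : ℝ) : a + b - 1 < omega γ a b := by
  rw [omega_eq]
  linarith [abs_lt_sqrt_radicand hγ a b, le_abs_self (a + b - 1)]

lemma omega_lt_iff {γ : ℝ} (hγ : -1 < γ) {a b d : ℝ} (h0 : 0 ≤ d) :
    omega γ a b < d ↔ (a - b) ^ 2 + 1 + γ < 6 * (d * (d - (a + b - 1))) := by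
  have h := omega_mul hγ a b
  have hp : 0 < d + omega γ a b - (a + b - 1) := by linarith [lt_omega hγ a b]
  rw [← h]
  constructor
  · intro hd
    nlinarith [mul_pos (sub_pos.2 hd) hp]
  · intro hd
    by_contra! hc
    nlinarith [mul_nonneg (sub_nonneg.2 hc) hp.le]

lemma omega_le_iff {γ : ℝ} (hγ : -1 < γ) {a b d : ℝ} (h0 : 0 ≤ d) :
    omega γ a b ≤ d ↔ (a - b) ^ 2 + 1 + γ ≤ 6 * (d * (d - (a + b - 1))) := by
  have h := omega_mul hγ a b
  have hp : 0 < d + omega γ a b - (a + b - 1) := by linarith [lt_omega hγ a b]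
  rw [← h]
  constructor
  · intro hd
    nlinarith [mul_nonneg (sub_nonneg.2 hd) hp.le]
  · intro hd
    by_contra! hc
    nlinarith [mul_pos (sub_pos.2 hc) hp]

/-- A larger value at `(a, b)` would push the gamma of the smallest such copula above `γ`; the value
`omega` itself is attained by `minCopula`. The last two hypotheses are the validity range of
`gini_minCopula`. -/
lemma upperBound_eq_omega {γ : ℝ} (hγ : γ ∈ Ioc (-1 : ℝ) 1) {a b : ℝ} (ha : a ∈ Icc (0 : ℝ) 1)
    (hb : b ∈ Icc (0 : ℝ) 1) (hωa : omega γ a b ≤ a) (hωb : omega γ a b ≤ b)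
    (h₁ : |a - b| ≤ omega γ a b) (h₂ : |a - b| ≤ omega γ a b - (a + b - 1)) :
    upperBound γ a b = omega γ a b := by
  have h0 := omega_pos hγ.1 a b
  have hs := lt_omega hγ.1 a b
  have hW : W a b ≤ omega γ a b := max_le h0.le hs.le
  refine le_antisymm (upperBound_le ⟨hγ.1.le, hγ.2⟩ fun C hC => ?_) ?_
  · by_contra! hlt
    have := gini_minCopula_le hC.1 ha hb
    have hM := hC.1.isQuasiCopula.le_M ha hb
    rw [hC.2, gini_minCopula ha hb (hM.trans (min_le_left _ _)) (hM.trans (min_le_right _ _))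
      (by linarith) (by linarith)] at this
    rw [omega_lt_iff hγ.1 (h0.trans hlt).le] at hlt
    linarith
  · have hm : minCopula a b (omega γ a b) ∈ giniClass γ := by
      refine ⟨isCopula_minCopula ha hb hW (le_min hωa hωb), ?_⟩
      rw [gini_minCopula ha hb hωa hωb h₁ h₂, omega_mul hγ.1]
      ring
    exact (minCopula_self hW).symm.trans_le (le_upperBound hm ha hb)

/-- The witness is the smallest copula with the maximal possible value `d = a`; `h` says that its
gamma is at most `γ`. -/
lemma le_upperBound_of_near {γ : ℝ} (hγ : γ ∈ Icc (0 : ℝ) 1) {a b : ℝ} (ha : a ∈ Icc (0 : ℝ) 1)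
    (hb : b ∈ Icc (0 : ℝ) 1) (hab : a ≤ b) (h₁ : b ≤ 2 * a) (h₂ : 2 * b ≤ 1 + a)
    (h : 6 * (a * (1 - b)) ≤ (a - b) ^ 2 + 1 + γ) : a ≤ upperBound γ a b := by
  have hc : |a - b| = b - a := by rw [abs_sub_comm, abs_of_nonneg (by linarith)]
  have hW : W a b ≤ a := max_le ha.1 (by linarith [hb.2])
  refine (minCopula_self hW).symm.trans_le (le_upperBound_of_gini_le hγ.2
    (isCopula_minCopula ha hb hW (le_min le_rfl hab)) ?_ ha hb)
  rw [gini_minCopula ha hb le_rfl hab (by linarith) (by linarith)]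
  linarith

/-- Outside the validity range of the gamma formula, `b` is lowered to the edge of that range, `2 *
a` or `(1 + a) / 2`; monotonicity of the bound carries the value back up. -/
lemma le_upperBound_of_le {γ : ℝ} (hγ : γ ∈ Icc (0 : ℝ) 1) {a b : ℝ} (ha : a ∈ Icc (0 : ℝ) 1)
    (hb : b ∈ Icc (0 : ℝ) 1) (hab : a ≤ b)
    (h : 6 * (a * (1 - b)) ≤ (a - b) ^ 2 + 1 + γ) : a ≤ upperBound γ a b := by
  have ha0 := ha.1; have ha1 := ha.2; have hγ0 := hγ.1; have hb1 := hb.2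
  have hmono : ∀ c ∈ Icc (0 : ℝ) 1, c ≤ b → a ≤ upperBound γ a c → a ≤ upperBound γ a b :=
    fun c hc hcb h => h.trans
      ((isQuasiCopula_upperBound ⟨by linarith, hγ.2⟩).mono_right a ha c hc b hb hcb)
  by_cases h₁ : b ≤ 2 * a
  · by_cases h₂ : 2 * b ≤ 1 + a
    · exact le_upperBound_of_near hγ ha hb hab h₁ h₂ h
    · push Not at h₂
      have hc : (1 + a) / 2 ∈ Icc (0 : ℝ) 1 := ⟨by linarith, by linarith⟩
      refine hmono _ hc (by linarith) (le_upperBound_of_near hγ ha hc (by linarith) (by linarith)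
        (by linarith) ?_)
      -- At `b = (1 + a) / 2` the claim reduces to `13a² - 14a + 5 + 4γ ≥ 0`, whose quadratic part
      -- in `a` has its minimum at `7/13`. At `b = 2a` it is `13a² - 6a + 1 + γ ≥ 0`, with minimum
      -- at `3/13`. Both use `γ ≥ 0`.
      nlinarith [sq_nonneg (a - 7 / 13)]
  · push Not at h₁
    by_cases h₂ : 3 * a ≤ 1
    · have hc : 2 * a ∈ Icc (0 : ℝ) 1 := ⟨by linarith, by linarith⟩
      refine hmono _ hc (by linarith) (le_upperBound_of_near hγ ha hc (by linarith) (by linarith)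
        (by linarith) ?_)
      nlinarith [sq_nonneg (a - 3 / 13)]
    · have hc : (1 + a) / 2 ∈ Icc (0 : ℝ) 1 := ⟨by linarith, by linarith⟩
      refine hmono _ hc (by linarith) (le_upperBound_of_near hγ ha hc (by linarith) (by linarith)
        (by linarith) ?_)
      nlinarith [sq_nonneg (a - 7 / 13)]

/-- For a nonnegative value of Gini's gamma the bound is `M` truncated by `omega`. -/
lemma upperBound_eq_min {γ : ℝ} (hγ : γ ∈ Icc (0 : ℝ) 1) {a b : ℝ} (ha : a ∈ Icc (0 : ℝ) 1)
    (hb : b ∈ Icc (0 : ℝ) 1) : upperBound γ a b = min (min a b) (omega γ a b) := by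
  have hγ' : γ ∈ Icc (-1 : ℝ) 1 := ⟨by linarith [hγ.1], hγ.2⟩
  have hγ1 : -1 < γ := by linarith [hγ.1]
  wlog hab : a ≤ b generalizing a b
  · rw [show upperBound γ a b = upperBound γ b a from isSymmetric_upperBound hγ' a ha b hb, this hb ha (le_of_not_ge hab), min_comm b a,
      omega_comm]
  rw [min_eq_left hab]
  have hiff := omega_le_iff hγ1 (a := a) (b := b) ha.1
  rcases le_total (omega γ a b) a with h | h
  · have h0 := omega_pos hγ1 a b
    have hs := lt_omega hγ1 a b
    have hm := omega_mul hγ1 a b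
    have hc : |a - b| = b - a := by rw [abs_sub_comm, abs_of_nonneg (by linarith)]
    rw [min_eq_right h]
    set x := omega γ a b
    have hx : x + (x - (a + b - 1)) + (b - a) ≤ 1 := by linarith
    -- Below the diagonal value `a`, `omega` automatically lies in the validity range: if `p < c`,
    -- then `6 p r ≤ 6 p (1 - 2 p)`, while `c² > p²`, and together they contradict `13p² - 6p + 1 >
    -- 0`.
    have key : ∀ p r c : ℝ, 0 < p → 0 < r → p + r + c ≤ 1 → 6 * (p * r) = c ^ 2 + 1 + γ →
        c ≤ p := by
      intro p r c hp hr h1 h2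
      by_contra! hlt
      have e1 : 6 * (p * r) ≤ 6 * (p * (1 - 2 * p)) := by nlinarith
      have e2 : p ^ 2 ≤ c ^ 2 := by nlinarith
      nlinarith [sq_nonneg (p - 3 / 13), hγ.1]
    refine upperBound_eq_omega ⟨hγ1, hγ.2⟩ ha hb h (h.trans hab) ?_ ?_
    · rw [hc]
      exact key _ _ _ h0 (sub_pos.2 hs) hx (by rw [hm]; ring)
    · rw [hc]
      exact key _ _ _ (sub_pos.2 hs) h0 (by linarith) (by rw [mul_comm (x - _), hm]; ring)
  · rw [min_eq_left h]
    refine le_antisymm (((isQuasiCopula_upperBound hγ').le_M ha hb).trans (min_le_left _ _))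
      (le_upperBound_of_le hγ ha hb hab ?_)
    rcases eq_or_lt_of_le h with h | h
    · have := omega_mul hγ1 a b
      rw [← h] at this
      linarith
    · have := not_le.1 (hiff.not.1 h.not_ge)
      linarith

lemma upperBound_of_half_le {γ : ℝ} (hγ : γ ∈ Icc (1 / 2 : ℝ) 1) :
    EqOnSquare (upperBound γ) M := by
  intro a ha b hb
  have h := hγ.1
  rw [upperBound_eq_min ⟨by linarith, hγ.2⟩ ha hb, M]
  refine min_eq_left (not_lt.1 fun hlt => ?_)
  wlog hab : a ≤ b generalizing a b
  · exact this b hb a ha (by rwa [omega_comm, min_comm]) (le_of_not_ge hab)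
  rw [min_eq_left hab, omega_lt_iff (by linarith) ha.1] at hlt
  -- For `a ≤ b` the quantity `6 a (1 - b) - (a - b)²` is at most `3/2`, its value at the centre, so
  -- `omega` cannot truncate `M`.
  nlinarith [sq_nonneg (a - (1 - b)), ha.1, hb.2]

/-! ### Negative parameter: a square of negative volume -/

/-- A quantitative form of the negative mixed derivative at `a + b - 1 = r`: here `X`, `Y`, `Z` are
the square roots of the radicand at the corners of a square of side `2h`. Squaring twice reduces the
claim to `0 < -γ - 4h²`. -/
lemma add_lt_two_mul_of_sq_eq {γ r h X Y Z : ℝ} (hr : r ^ 2 = 1 / 3) (hγ : -1 < γ) (hh : 0 < h)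
    (hlt : 4 * h ^ 2 < -γ) (hZ : 0 ≤ Z)
    (e₁ : X ^ 2 = (r - 2 * h) ^ 2 + 2 / 3 * (1 + γ))
    (e₂ : Y ^ 2 = (r + 2 * h) ^ 2 + 2 / 3 * (1 + γ))
    (e₃ : Z ^ 2 = r ^ 2 + 2 / 3 * (4 * h ^ 2 + 1 + γ)) : X + Y < 2 * Z := by
  by_contra! hsum
  have hsq := pow_le_pow_left₀ (by positivity) hsum 2
  obtain ⟨q, hq⟩ : ∃ q : ℝ, q = r ^ 2 + 2 / 3 * (1 + γ) := ⟨_, rfl⟩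
  have hXY : q + 4 * h ^ 2 / 3 ≤ X * Y := by
    have : (2 * Z) ^ 2 = 4 * Z ^ 2 := by ring
    have : (X + Y) ^ 2 = X ^ 2 + Y ^ 2 + 2 * (X * Y) := by ring
    linarith
  have hq0 : 0 < q := by rw [hq, hr]; linarith
  have hXY2 := pow_le_pow_left₀ (by positivity) hXY 2
  have hprod : (X * Y) ^ 2 = (q + 4 * h ^ 2) ^ 2 - 16 * r ^ 2 * h ^ 2 := by
    rw [mul_pow, e₁, e₂, hq]; ring
  have hneg : 0 < h ^ 2 * (16 * r ^ 2 - 16 / 3 * q - 128 / 9 * h ^ 2) := by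
    apply mul_pos (by positivity)
    rw [hq, hr]
    linarith [sq_nonneg h]
  linarith

lemma not_isCopula_upperBound {γ : ℝ} (hγ : γ ∈ Ioo (-1 : ℝ) 0) : ¬ IsCopula (upperBound γ) := by
  intro hG
  obtain ⟨hγ1, hγ0⟩ := hγ
  obtain ⟨r, hr, hr0⟩ : ∃ r : ℝ, r ^ 2 = 1 / 3 ∧ 0 < r :=
    ⟨√(1 / 3), Real.sq_sqrt (by norm_num), Real.sqrt_pos.2 (by norm_num)⟩
  have hr1 : r < 3 / 5 := by nlinarith
  have hr2 : 1 / 2 < r := by nlinarith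
  -- The half-side is small compared with both `1 + γ`, keeping the corners in the validity range of
  -- `omega`, and `-γ`, keeping them in the region and making `4h² < -γ`.
  obtain ⟨h, hh⟩ : ∃ h : ℝ, h = (1 + γ) * (-γ) / 100 := ⟨_, rfl⟩
  have hh0 : 0 < h := by rw [hh]; exact div_pos (mul_pos (by linarith) (by linarith)) (by norm_num)
  have hh1 : h ≤ (1 + γ) / 100 := by rw [hh]; nlinarith
  have hh2 : h ≤ -γ / 100 := by rw [hh]; nlinarith
  -- The diagonal point with `6 p (1 - p) = 1`: it lies inside the region exactly when `γ < 0`.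
  obtain ⟨p, hp⟩ : ∃ p : ℝ, p = (1 + r) / 2 := ⟨_, rfl⟩
  have hhsq : h ^ 2 ≤ h / 100 := by nlinarith
  have hm₁ : p - h ∈ Icc (0 : ℝ) 1 := ⟨by linarith, by linarith⟩
  have hm₂ : p + h ∈ Icc (0 : ℝ) 1 := ⟨by linarith, by linarith⟩
  have hval : ∀ a ∈ Icc (0 : ℝ) 1, ∀ b ∈ Icc (0 : ℝ) 1, a ≤ b → b - a ≤ 2 * h →
      (a - b) ^ 2 + 1 + γ ≤ 6 * (a * (1 - b)) → upperBound γ a b = omega γ a b := by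
    intro a ha b hb hab hba hle
    have hω : omega γ a b ≤ a :=
      (omega_le_iff hγ1 ha.1).2 (hle.trans_eq (by ring))
    have hc : |a - b| = b - a := by rw [abs_sub_comm, abs_of_nonneg (by linarith)]
    have h0 := omega_pos hγ1 a b
    have hs := lt_omega hγ1 a b
    have hmul := omega_mul hγ1 a b
    have := ha.2; have := hb.1
    refine upperBound_eq_omega ⟨hγ1, by linarith⟩ ha hb hω (hω.trans hab) ?_ ?_
    · rw [hc]; nlinarith [sq_nonneg (a - b)]
    · rw [hc]; nlinarith [sq_nonneg (a - b)]
  have hrh : r * h ≤ 3 / 5 * h := by nlinarith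
  have v₁ := hval (p - h) hm₁ (p - h) hm₁ le_rfl (by linarith) (by subst hp; nlinarith)
  have v₂ := hval (p + h) hm₂ (p + h) hm₂ le_rfl (by linarith) (by subst hp; nlinarith)
  have v₃ := hval (p - h) hm₁ (p + h) hm₂ (by linarith) (by linarith) (by subst hp; nlinarith)
  have v₄ : upperBound γ (p - h) (p + h) = upperBound γ (p + h) (p - h) :=
    isSymmetric_upperBound ⟨hγ1.le, by linarith⟩ (p - h) hm₁ (p + h) hm₂
  have vol := hG.two_increasing (p - h) hm₁ (p + h) hm₂ (p - h) hm₁ (p + h) hm₂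
    (by linarith) (by linarith)
  rw [← v₄, v₁, v₂, v₃, omega_eq, omega_eq, omega_eq] at vol
  have s₁ := Real.sq_sqrt (radicand_pos hγ1 (p - h) (p - h)).le
  have s₂ := Real.sq_sqrt (radicand_pos hγ1 (p + h) (p + h)).le
  have s₃ := Real.sq_sqrt (radicand_pos hγ1 (p - h) (p + h)).le
  have n₃ := Real.sqrt_nonneg (radicand γ (p - h) (p + h))
  set X := √(radicand γ (p - h) (p - h))
  set Y := √(radicand γ (p + h) (p + h))
  set Z := √(radicand γ (p - h) (p + h))
  have e₁ : X ^ 2 = (r - 2 * h) ^ 2 + 2 / 3 * (1 + γ) := by rw [s₁, radicand, hp]; ring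
  have e₂ : Y ^ 2 = (r + 2 * h) ^ 2 + 2 / 3 * (1 + γ) := by rw [s₂, radicand, hp]; ring
  have e₃ : Z ^ 2 = r ^ 2 + 2 / 3 * (4 * h ^ 2 + 1 + γ) := by rw [s₃, radicand, hp]; ring
  have hh3 : 4 * h ^ 2 < -γ := by linarith
  linarith [add_lt_two_mul_of_sq_eq hr hγ1 hh0 hh3 n₃ e₁ e₂ e₃]


/-! ### The region and its boundary curves -/

/-- The upper boundary of the region, continued by the diagonal. -/
def upperCurve (γ a : ℝ) : ℝ := max a (-(2 * a) + √(3 * a ^ 2 + 6 * a - (1 + γ)))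

/-- The lower boundary of the region, continued by the diagonal. -/
def lowerCurve (γ a : ℝ) : ℝ := 1 - upperCurve γ (1 - a)

lemma continuous_upperCurve (γ : ℝ) : Continuous (upperCurve γ) := by
  unfold upperCurve
  fun_prop

lemma continuous_lowerCurve (γ : ℝ) : Continuous (lowerCurve γ) :=
  continuous_const.sub ((continuous_upperCurve γ).comp (by fun_prop))

lemma le_upperCurve (γ a : ℝ) : a ≤ upperCurve γ a := le_max_left _ _

lemma lowerCurve_le (γ a : ℝ) : lowerCurve γ a ≤ a := by
  have := le_upperCurve γ (1 - a)
  unfold lowerCurve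
  linarith

/-- The root defining `upperCurve` solves `(a - b)² + 1 + γ = 6 a (1 - b)` for `b`. Where its
radicand is negative the square root is `0` by convention and the curve falls back to the diagonal,
so no case distinction is needed. -/
lemma lt_upperCurve_iff {γ a b : ℝ} (ha : 0 ≤ a) (hab : a ≤ b) :
    b < upperCurve γ a ↔ (a - b) ^ 2 + 1 + γ < 6 * (a * (1 - b)) := by
  have h : b < upperCurve γ a ↔ b + 2 * a < √(3 * a ^ 2 + 6 * a - (1 + γ)) := by
    rw [upperCurve, lt_max_iff]
    constructor
    · rintro (h | h) <;> linarith
    · intro h; right; linarith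
  rw [h, Real.lt_sqrt (by linarith)]
  constructor <;> intro h <;> linarith

lemma lowerCurve_lt_iff {γ a b : ℝ} (ha : a ≤ 1) (hab : b ≤ a) :
    lowerCurve γ a < b ↔ (a - b) ^ 2 + 1 + γ < 6 * (b * (1 - a)) := by
  rw [lowerCurve, sub_lt_comm, lt_upperCurve_iff (by linarith) (by linarith)]
  constructor <;> intro h <;> linarith

lemma upperCurve_le_one {γ a : ℝ} (hγ : -1 < γ) (ha : a ∈ Icc (0 : ℝ) 1) :
    upperCurve γ a ≤ 1 := by
  rw [← not_lt, lt_upperCurve_iff ha.1 ha.2]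
  nlinarith [sq_nonneg (a - 1)]

lemma upperCurve_mem {γ a : ℝ} (hγ : -1 < γ) (ha : a ∈ Icc (0 : ℝ) 1) :
    upperCurve γ a ∈ Icc (0 : ℝ) 1 :=
  ⟨ha.1.trans (le_upperCurve γ a), upperCurve_le_one hγ ha⟩

lemma lowerCurve_mem {γ a : ℝ} (hγ : -1 < γ) (ha : a ∈ Icc (0 : ℝ) 1) :
    lowerCurve γ a ∈ Icc (0 : ℝ) 1 :=
  one_sub_mem_Icc (upperCurve_mem hγ (one_sub_mem_Icc ha))

lemma upperCurve_spec {γ a : ℝ} (ha : 0 ≤ a) (h : a < upperCurve γ a) :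
    (a - upperCurve γ a) ^ 2 + 1 + γ = 6 * (a * (1 - upperCurve γ a)) := by
  have hU : upperCurve γ a = -(2 * a) + √(3 * a ^ 2 + 6 * a - (1 + γ)) := by
    rw [upperCurve, lt_max_iff] at h
    exact max_eq_right (h.resolve_left (lt_irrefl a)).le
  have hs : 0 < √(3 * a ^ 2 + 6 * a - (1 + γ)) := by linarith
  have := Real.mul_self_sqrt (Real.sqrt_pos.1 hs).le
  rw [hU]
  linear_combination this

lemma strictMonoOn_upperCurve {γ : ℝ} (hγ : -1 < γ) :
    StrictMonoOn (upperCurve γ) (Icc 0 1) := by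
  intro a ha a' ha' haa'
  rcases lt_or_ge (upperCurve γ a) a' with h | h
  · exact h.trans_le (le_upperCurve γ a')
  have hs := upperCurve_spec ha.1 (haa'.trans_le h)
  rw [lt_upperCurve_iff ha'.1 h]
  have h1 := upperCurve_le_one hγ ha
  have h2 : upperCurve γ a ≠ 1 := by
    intro h2
    rw [h2] at hs
    nlinarith [sq_nonneg (a - 1)]
  have h3 := lt_of_le_of_ne h1 h2
  -- With `b = upperCurve γ a` fixed, passing from `a` to `a'` changes `6 a (1 - b) - (a - b)²` by
  -- `(a' - a) (6 - 4b - a - a')`, and `a < a' ≤ b < 1`.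
  nlinarith [mul_pos (sub_pos.2 haa')
    (show 0 < 6 - 4 * upperCurve γ a - a - a' by linarith)]

lemma strictMonoOn_lowerCurve {γ : ℝ} (hγ : -1 < γ) :
    StrictMonoOn (lowerCurve γ) (Icc 0 1) := by
  intro a ha a' ha' haa'
  have := strictMonoOn_upperCurve hγ (one_sub_mem_Icc ha') (one_sub_mem_Icc ha)
    (show 1 - a' < 1 - a by linarith)
  unfold lowerCurve
  linarith

lemma lowerCurve_lt_self_iff {γ a : ℝ} (ha : a ∈ Icc (0 : ℝ) 1) :
    lowerCurve γ a < a ↔ a < upperCurve γ a := by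
  rw [lowerCurve_lt_iff ha.2 le_rfl, lt_upperCurve_iff ha.1 le_rfl]

lemma mem_region_iff_of_le {γ a b : ℝ} (hγ : -1 < γ) (ha : 0 ≤ a) (hab : a ≤ b) :
    (a, b) ∈ region γ ↔ (a - b) ^ 2 + 1 + γ < 6 * (a * (1 - b)) := by
  have : (a, b) ∈ region γ ↔ omega γ a b < a := ⟨fun h => h.1, fun h => ⟨h, h.trans_le hab⟩⟩
  rw [this, omega_lt_iff hγ ha]
  constructor <;> intro h <;> linarith

lemma mem_region_iff_of_ge {γ a b : ℝ} (hγ : -1 < γ) (hb : 0 ≤ b) (hab : b ≤ a) :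
    (a, b) ∈ region γ ↔ (a - b) ^ 2 + 1 + γ < 6 * (b * (1 - a)) := by
  have : (a, b) ∈ region γ ↔ omega γ a b < b := ⟨fun h => h.2, fun h => ⟨h.trans_le hab, h⟩⟩
  rw [this, omega_lt_iff hγ hb]
  constructor <;> intro h <;> linarith

lemma region_subset_Ioo {γ : ℝ} (hγ : -1 < γ) : region γ ⊆ Ioo (0 : ℝ) 1 ×ˢ Ioo (0 : ℝ) 1 := by
  rintro ⟨a, b⟩ ⟨h₁, h₂⟩
  have h0 := omega_pos hγ a b
  have hs := lt_omega hγ a b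
  simp only at h₁ h₂
  exact ⟨⟨h0.trans h₁, by linarith⟩, ⟨h0.trans h₂, by linarith⟩⟩

lemma region_subset {γ : ℝ} (hγ : -1 < γ) : region γ ⊆ Icc (0 : ℝ) 1 ×ˢ Icc (0 : ℝ) 1 :=
  (region_subset_Ioo hγ).trans (prod_mono Ioo_subset_Icc_self Ioo_subset_Icc_self)

lemma mem_region_iff {γ : ℝ} (hγ : -1 < γ) {a b : ℝ} (ha : a ∈ Icc (0 : ℝ) 1) :
    (a, b) ∈ region γ ↔ lowerCurve γ a < b ∧ b < upperCurve γ a := by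
  rcases le_total a b with hab | hab
  · rw [mem_region_iff_of_le hγ ha.1 hab, ← lt_upperCurve_iff ha.1 hab, iff_and_self]
    exact fun h => ((lowerCurve_lt_self_iff ha).2 (hab.trans_lt h)).trans_le hab
  · constructor
    · intro h
      have hb := (region_subset hγ h).2.1
      rw [mem_region_iff_of_ge hγ hb hab, ← lowerCurve_lt_iff ha.2 hab] at h
      exact ⟨h, hab.trans_lt ((lowerCurve_lt_self_iff ha).1 (h.trans_le hab))⟩
    · rintro ⟨h, -⟩
      rw [mem_region_iff_of_ge hγ ((lowerCurve_mem hγ ha).1.trans h.le) hab,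
        ← lowerCurve_lt_iff ha.2 hab]
      exact h

lemma continuous_omega (γ : ℝ) : Continuous fun p : ℝ × ℝ => omega γ p.1 p.2 := by
  unfold omega
  fun_prop

lemma isOpen_region (γ : ℝ) : IsOpen (region γ) :=
  (isOpen_lt (continuous_omega γ) continuous_fst).inter
    (isOpen_lt (continuous_omega γ) continuous_snd)

lemma center_mem_region {γ : ℝ} (hγ : -1 < γ) (hγ' : γ < 1 / 2) :
    ((1 / 2, 1 / 2) : ℝ × ℝ) ∈ region γ := by
  rw [mem_region_iff_of_le hγ (by norm_num) le_rfl]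
  linarith

lemma swap_mem_region {γ a b : ℝ} : (b, a) ∈ region γ ↔ (a, b) ∈ region γ := by
  simp only [region, mem_ofPred_eq, omega_comm γ b a]
  exact and_comm

lemma starConvex_region {γ : ℝ} (hγ : -1 < γ) :
    StarConvex ℝ ((1 / 2, 1 / 2) : ℝ × ℝ) (region γ) := by
  rintro ⟨a, b⟩ hp s t hs ht hst
  have e : s • ((1 / 2, 1 / 2) : ℝ × ℝ) + t • (a, b) = (s / 2 + t * a, s / 2 + t * b) := by
    ext <;> simp <;> ring
  rw [e]
  clear e
  wlog hab : a ≤ b generalizing a b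
  · exact swap_mem_region.1 (this b a (swap_mem_region.1 hp) (le_of_not_ge hab))
  obtain ⟨⟨ha0, ha1⟩, hb0, hb1⟩ := region_subset_Ioo hγ hp
  simp only at ha0 ha1 hb0 hb1
  obtain rfl : s = 1 - t := by linarith
  rw [mem_region_iff_of_le hγ (by positivity) (by nlinarith)]
  rw [mem_region_iff_of_le hγ ha0.le hab] at hp
  have hc : (b - a) ^ 2 ≤ b - a := by nlinarith
  -- In terms of `c = b - a` and `e = a + b - 1`, the region for `c ≥ 0` is `0 < 1/2 - γ - 3c + c²/2
  -- - 3e²/2`. Shrinking towards the centre multiplies `c` and `e` by `t`, and the expression below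
  -- is the resulting gain.
  have key : 0 ≤ (1 - t) * (3 * (b - a) - (1 + t) * ((b - a) ^ 2 / 2)
      + 3 / 2 * ((1 + t) * (a + b - 1) ^ 2)) := by
    apply mul_nonneg hs
    have : 0 ≤ 3 / 2 * ((1 + t) * (a + b - 1) ^ 2) := by positivity
    nlinarith
  linarith

lemma isConnected_region {γ : ℝ} (hγ : -1 < γ) (hγ' : γ < 1 / 2) : IsConnected (region γ) :=
  ((starConvex_region hγ).isPathConnected (center_mem_region hγ hγ')).isConnected

lemma frontier_region_subset (γ : ℝ) : frontier (region γ) ⊆ hyperbolas γ := by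
  rw [(isOpen_region γ).frontier_eq]
  rintro p ⟨hc, hp⟩
  have hsub : region γ ⊆ {p : ℝ × ℝ | omega γ p.1 p.2 ≤ p.1 ∧ omega γ p.1 p.2 ≤ p.2} :=
    fun p hp => ⟨hp.1.le, hp.2.le⟩
  have hle := closure_minimal hsub ((isClosed_le (continuous_omega γ) continuous_fst).inter
    (isClosed_le (continuous_omega γ) continuous_snd)) hc
  by_contra hn
  simp only [hyperbolas, mem_union, mem_ofPred_eq, not_or] at hn
  exact hp ⟨lt_of_le_of_ne hle.1 hn.1, lt_of_le_of_ne hle.2 hn.2⟩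

/-- The union of the two boundary curves. -/
def curves (γ : ℝ) : Set (ℝ × ℝ) :=
  {p | p.1 ∈ Icc (0 : ℝ) 1 ∧ (p.2 = upperCurve γ p.1 ∨ p.2 = lowerCurve γ p.1)}

lemma closure_region_subset {γ : ℝ} (hγ : -1 < γ) : closure (region γ) ⊆
    {p | p.1 ∈ Icc (0 : ℝ) 1 ∧ lowerCurve γ p.1 ≤ p.2 ∧ p.2 ≤ upperCurve γ p.1} := by
  refine closure_minimal (fun p hp => ?_) ?_
  · have h1 := (region_subset hγ hp).1
    have := (mem_region_iff hγ h1).1 hp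
    exact ⟨h1, this.1.le, this.2.le⟩
  · exact (isClosed_Icc.preimage continuous_fst).inter
      ((isClosed_le ((continuous_lowerCurve γ).comp continuous_fst) continuous_snd).inter
        (isClosed_le continuous_snd ((continuous_upperCurve γ).comp continuous_fst)))

lemma mem_closure_region {γ : ℝ} (hγ : -1 < γ) {a b : ℝ} (ha : a ∈ Icc (0 : ℝ) 1)
    (h : lowerCurve γ a < upperCurve γ a) (hb : b ∈ Icc (lowerCurve γ a) (upperCurve γ a)) :
    (a, b) ∈ closure (region γ) := by
  rw [← closure_Ioo h.ne] at hb
  exact map_mem_closure (f := fun b => (a, b)) (by fun_prop) hb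
    fun x hx => (mem_region_iff hγ ha).2 hx

/-- Where the curves separate they bound the region; where they coincide they both run along the
diagonal. The prescribed support of the singular part is thus just the union of two graphs. -/
lemma frontier_union_diagonal {γ : ℝ} (hγ : -1 < γ) :
    frontier (region γ) ∪ (diagonal \ closure (region γ)) = curves γ := by
  rw [(isOpen_region γ).frontier_eq]
  ext ⟨a, b⟩
  constructor
  · rintro (⟨hc, hn⟩ | ⟨⟨hab, ha⟩, hn⟩)
    · obtain ⟨ha, hl, hu⟩ := closure_region_subset hγ hc
      simp only at ha hl hu
      rw [mem_region_iff hγ ha, not_and_or, not_lt, not_lt] at hn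
      exact ⟨ha, hn.symm.imp hu.antisymm fun h => h.antisymm hl⟩
    · simp only at hab ha
      subst hab
      have hl := lowerCurve_le γ a
      have hu := le_upperCurve γ a
      refine ⟨ha, Or.inl ?_⟩
      by_contra h
      have h' := lt_of_le_of_ne hu h
      exact hn (mem_closure_region hγ ha (hl.trans_lt h') ⟨hl, hu⟩)
  · rintro ⟨ha, hb⟩
    simp only at ha hb
    have hl := lowerCurve_le γ a
    have hu := le_upperCurve γ a
    have hlu := lowerCurve_lt_self_iff (γ := γ) ha
    have hnot : (a, b) ∉ region γ := by
      rw [mem_region_iff hγ ha]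
      rcases hb with rfl | rfl
      · exact fun h => lt_irrefl _ h.2
      · exact fun h => lt_irrefl _ h.1
    by_cases hc : (a, b) ∈ closure (region γ)
    · exact Or.inl ⟨hc, hnot⟩
    · refine Or.inr ⟨⟨?_, ha⟩, hc⟩
      by_contra hne
      have hlt : lowerCurve γ a < upperCurve γ a := by
        rcases hb with rfl | rfl
        · exact hl.trans_lt (lt_of_le_of_ne hu hne)
        · exact (lt_of_le_of_ne hl (Ne.symm hne)).trans_le hu
      refine hc (mem_closure_region hγ ha hlt ?_)
      rcases hb with rfl | rfl
      · exact ⟨hlt.le, le_rfl⟩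
      · exact ⟨le_rfl, hlt.le⟩


/-! ### Measures carried by a graph -/

open Topology in
lemma measure_pos_of_mem_closure_open {X : Type*} [TopologicalSpace X] [MeasurableSpace X]
    {μ : Measure X} [μ.IsOpenPosMeasure] {s U : Set X} (hs : IsOpen s) {x : X}
    (hx : x ∈ closure s) (hU : U ∈ 𝓝 x) : 0 < μ (s ∩ U) := by
  obtain ⟨V, hVU, hV, hxV⟩ := mem_nhds_iff.1 hU
  obtain ⟨y, hyV, hys⟩ := mem_closure_iff.1 hx V hV hxV
  exact ((hs.inter hV).measure_pos μ ⟨y, hys, hyV⟩).trans_le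
    (measure_mono (inter_subset_inter_right s hVU))

/-- The measure on the graph of `f` over the unit interval whose projection has density `w`. -/
def curveMeasure (f w : ℝ → ℝ) : Measure (ℝ × ℝ) :=
  ((volume.restrict (Icc (0 : ℝ) 1)).withDensity fun a => ENNReal.ofReal (w a)).map
    fun a => (a, f a)

/-- The graph of `f` over the unit interval. -/
def curve (f : ℝ → ℝ) : Set (ℝ × ℝ) := {p | p.1 ∈ Icc (0 : ℝ) 1 ∧ p.2 = f p.1}

lemma isClosed_curve {f : ℝ → ℝ} (hf : Continuous f) : IsClosed (curve f) :=
  (isClosed_Icc.preimage continuous_fst).inter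
    (isClosed_eq continuous_snd (hf.comp continuous_fst))

lemma curveMeasure_apply {f : ℝ → ℝ} (hf : Continuous f) (w : ℝ → ℝ) {s : Set (ℝ × ℝ)}
    (hs : MeasurableSet s) : curveMeasure f w s =
      ∫⁻ a in (fun a => (a, f a)) ⁻¹' s ∩ Icc 0 1, ENNReal.ofReal (w a) := by
  have hm : Measurable fun a => (a, f a) := by fun_prop
  rw [curveMeasure, Measure.map_apply hm hs, withDensity_apply _ (hm hs),
    Measure.restrict_restrict (hm hs)]

lemma curveMeasure_compl_curve {f : ℝ → ℝ} (hf : Continuous f) (w : ℝ → ℝ) :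
    curveMeasure f w (curve f)ᶜ = 0 := by
  rw [curveMeasure_apply hf w (isClosed_curve hf).measurableSet.compl]
  have : (fun a => (a, f a)) ⁻¹' (curve f)ᶜ ∩ Icc 0 1 = ∅ := by
    ext a
    simp [curve]
  rw [this]
  simp

lemma curveMeasure_rect {f : ℝ → ℝ} (hf : Continuous f) (w : ℝ → ℝ)
    (hmaps : MapsTo f (Icc 0 1) (Icc 0 1)) {u : ℝ} (hu : u ≤ 1) (v : ℝ) :
    curveMeasure f w (Icc 0 u ×ˢ Icc 0 v) =
      ∫⁻ a in Icc 0 u, {a | f a ≤ v}.indicator (fun a => ENNReal.ofReal (w a)) a := by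
  rw [curveMeasure_apply hf w (measurableSet_Icc.prod measurableSet_Icc),
    setLIntegral_indicator (measurableSet_le hf.measurable measurable_const)]
  congr 2
  ext a
  constructor
  · rintro ⟨⟨h1, h2⟩, -⟩
    exact ⟨h2.2, h1⟩
  · rintro ⟨h1, h2⟩
    have ha : a ∈ Icc (0 : ℝ) 1 := ⟨h2.1, h2.2.trans hu⟩
    exact ⟨⟨h2, (hmaps ha).1, h1⟩, ha⟩

lemma volume_curve {f : ℝ → ℝ} (hf : Continuous f) : volume (curve f) = 0 := by
  rw [Measure.volume_eq_prod, Measure.measure_prod_null (isClosed_curve hf).measurableSet]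
  refine Filter.Eventually.of_forall fun a => measure_mono_null (t := {f a}) ?_ (by simp)
  exact fun b hb => hb.2

lemma curveMeasure_mutuallySingular {f : ℝ → ℝ} (hf : Continuous f) (w : ℝ → ℝ) :
    curveMeasure f w ⟂ₘ volume :=
  (Measure.MutuallySingular.mk (s := (curve f)ᶜ) (t := curve f) (curveMeasure_compl_curve hf w)
    (volume_curve hf) (by simp))

lemma support_curveMeasure {f w : ℝ → ℝ} (hf : Continuous f) (hwc : Continuous w)
    (hw : ∀ a ∈ Icc (0 : ℝ) 1, 0 < w a) : (curveMeasure f w).support = curve f := by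
  refine (Measure.support_subset_of_isClosed (isClosed_curve hf)
    (mem_ae_iff.2 (curveMeasure_compl_curve hf w))).antisymm ?_
  rintro ⟨a, b⟩ ⟨ha, hb⟩
  simp only at ha hb
  subst hb
  have hm : Continuous fun a => (a, f a) := by fun_prop
  rw [Measure.mem_support_iff_forall]
  intro U hU
  refine lt_of_lt_of_le ?_ (Measure.le_map_apply hm.measurable.aemeasurable U)
  have hV := hm.continuousAt.preimage_mem_nhds hU
  rw [pos_iff_ne_zero]
  intro h0
  rw [withDensity_apply_eq_zero (by fun_prop)] at h0
  -- Passing to the closure of the open interval covers the two endpoints of the graph, whose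
  -- neighbourhoods still meet a set of positive length.
  have hcl : a ∈ closure (Ioo (0 : ℝ) 1) := by rwa [closure_Ioo zero_ne_one]
  refine (measure_pos_of_mem_closure_open (μ := volume) isOpen_Ioo hcl hV).ne'
    (measure_mono_null ?_ (nonpos_iff_eq_zero.1 ((Measure.le_restrict_apply _ _).trans h0.le)))
  rintro x ⟨hx, hxU⟩
  have hx' := Ioo_subset_Icc_self hx
  exact ⟨⟨(ENNReal.ofReal_pos.2 (hw x hx')).ne', hxU⟩, hx'⟩

/-! ### Derivatives of `omega` and their signs -/

/-- The partial derivative of `omega` in the first variable. -/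
def omegaFst (γ a b : ℝ) : ℝ :=
  1 / 2 + ((a + b - 1) + 2 / 3 * (a - b)) / (2 * √(radicand γ a b))

/-- The mixed second partial derivative of `omega`. -/
def density (γ a b : ℝ) : ℝ :=
  ((a - b) ^ 2 + (1 + γ) / 3 - (a + b - 1) ^ 2) / (3 * (radicand γ a b * √(radicand γ a b)))

lemma hasDerivAt_omega {γ : ℝ} (hγ : -1 < γ) (a b : ℝ) :
    HasDerivAt (fun a => omega γ a b) (omegaFst γ a b) a := by
  have hq := radicand_pos hγ a b
  have hr : HasDerivAt (fun a => radicand γ a b)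
      (2 * (a + b - 1) + 2 / 3 * (2 * (a - b))) a := by
    have h1 := ((((hasDerivAt_id a).add_const b).sub_const 1).pow 2)
    have h2 := (((hasDerivAt_id a).sub_const b).pow 2)
    convert! h1.add ((((h2.add_const 1).add_const γ)).const_mul (2 / 3)) using 1
    simp
  have h := ((((hasDerivAt_id a).add_const b).sub_const 1).div_const 2).add
    ((hr.sqrt hq.ne').div_const 2)
  have e : (fun a => omega γ a b) = fun a => (a + b - 1) / 2 + √(radicand γ a b) / 2 :=
    funext fun a => omega_eq γ a b
  rw [e]
  convert! h using 1
  rw [omegaFst]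
  ring

lemma hasDerivAt_omegaFst {γ : ℝ} (hγ : -1 < γ) (a b : ℝ) :
    HasDerivAt (fun b => omegaFst γ a b) (density γ a b) b := by
  have hq := radicand_pos hγ a b
  have hs := Real.sqrt_pos.2 hq
  have hss := Real.mul_self_sqrt hq.le
  have hr : HasDerivAt (fun b => radicand γ a b)
      (2 * (a + b - 1) - 2 / 3 * (2 * (a - b))) b := by
    have h1 := ((((hasDerivAt_id b).const_add a).sub_const 1).pow 2)
    have h2 := (((hasDerivAt_id b).const_sub a).pow 2)
    convert! h1.add ((((h2.add_const 1).add_const γ)).const_mul (2 / 3)) using 1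
    simp
    ring
  have hn : HasDerivAt (fun b => (a + b - 1) + 2 / 3 * (a - b)) (1 / 3) b := by
    have h := (((hasDerivAt_id b).const_add a).sub_const 1).add
      (((hasDerivAt_id b).const_sub a).const_mul (2 / 3))
    convert! h using 1
    norm_num
  have h := (hn.div ((hr.sqrt hq.ne').const_mul 2) (by positivity)).const_add (1 / 2)
  refine h.congr_deriv ?_
  rw [density]
  set q := √(radicand γ a b)
  rw [← hss]
  field_simp
  have hq2 : q ^ 2 = (a + b - 1) ^ 2 + 2 / 3 * ((a - b) ^ 2 + 1 + γ) := by
    rw [sq, hss, radicand]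
  rw [hq2]
  ring

lemma continuous_radicand (γ : ℝ) : Continuous fun p : ℝ × ℝ => radicand γ p.1 p.2 := by
  unfold radicand
  fun_prop

lemma continuous_omegaFst {γ : ℝ} (hγ : -1 < γ) :
    Continuous fun p : ℝ × ℝ => omegaFst γ p.1 p.2 := by
  unfold omegaFst
  refine continuous_const.add (Continuous.div (by fun_prop)
    (continuous_const.mul (continuous_radicand γ).sqrt) fun p => ?_)
  have := Real.sqrt_pos.2 (radicand_pos hγ p.1 p.2)
  positivity

lemma continuous_density {γ : ℝ} (hγ : -1 < γ) :
    Continuous fun p : ℝ × ℝ => density γ p.1 p.2 := by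
  unfold density
  refine Continuous.div (by fun_prop) (continuous_const.mul
    ((continuous_radicand γ).mul (continuous_radicand γ).sqrt)) fun p => ?_
  have h := radicand_pos hγ p.1 p.2
  have := Real.sqrt_pos.2 h
  positivity

/-- With `c = |a - b|`, membership in the region gives `(a + b - 1)² < 1/3 - 2γ/3 - 2c + c²/3`,
which is at most `1/3 + γ/3 + c²` because `γ ≥ 0`. -/
lemma density_pos {γ : ℝ} (hγ : 0 ≤ γ) {a b : ℝ} (h : (a, b) ∈ region γ) :
    0 < density γ a b := by
  have hγ' : -1 < γ := by linarith
  have hq := radicand_pos hγ' a b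
  have := Real.sqrt_pos.2 hq
  refine div_pos ?_ (by positivity)
  obtain ⟨⟨ha0, ha1⟩, hb0, hb1⟩ := region_subset_Ioo hγ' h
  simp only at ha0 ha1 hb0 hb1
  rcases le_total a b with hab | hab
  · rw [mem_region_iff_of_le hγ' ha0.le hab] at h
    nlinarith
  · rw [mem_region_iff_of_ge hγ' hb0.le hab] at h
    nlinarith

lemma omegaFst_mem_of_sq_lt {γ a b : ℝ}
    (h : ((a + b - 1) + 2 / 3 * (a - b)) ^ 2 < radicand γ a b) : omegaFst γ a b ∈ Ioo (0 : ℝ) 1 := by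
  have habs := abs_lt.1 (Real.lt_sqrt_of_sq_lt ((sq_abs _).trans_lt h))
  have hs : 0 < √(radicand γ a b) := by linarith [habs.1, habs.2]
  have h1 : -(1 / 2) < ((a + b - 1) + 2 / 3 * (a - b)) / (2 * √(radicand γ a b)) := by
    rw [lt_div_iff₀ (by positivity)]; linarith [habs.1]
  have h2 : ((a + b - 1) + 2 / 3 * (a - b)) / (2 * √(radicand γ a b)) < 1 / 2 := by
    rw [div_lt_iff₀ (by positivity)]; linarith [habs.2]
  unfold omegaFst
  constructor <;> linarith

/-- Strictness up to and including the curves makes the weights of the singular part positive, so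
that its support is all of both graphs. -/
lemma omegaFst_mem {γ : ℝ} (hγ : 0 ≤ γ) {a b : ℝ} (ha : a ∈ Icc (0 : ℝ) 1)
    (hb : b ∈ Icc (lowerCurve γ a) (upperCurve γ a)) : omegaFst γ a b ∈ Ioo (0 : ℝ) 1 := by
  have hγ' : -1 < γ := by linarith
  apply omegaFst_mem_of_sq_lt
  have hb0 := (lowerCurve_mem hγ' ha).1.trans hb.1
  have hb1 := hb.2.trans (upperCurve_mem hγ' ha).2
  rw [radicand]
  rcases lt_trichotomy a b with hab | rfl | hab
  · have h : (a - b) ^ 2 + 1 + γ ≤ 6 * (a * (1 - b)) := by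
      rcases eq_or_lt_of_le hb.2 with h | h
      · rw [h] at hab ⊢
        exact (upperCurve_spec ha.1 hab).le
      · exact ((lt_upperCurve_iff ha.1 hab.le).1 h).le
    have : (b - a) ^ 2 ≤ b - a := by nlinarith [ha.1, ha.2]
    nlinarith [sq_nonneg (a + b - 1 - (a - b))]
  · nlinarith
  · have h : (a - b) ^ 2 + 1 + γ ≤ 6 * (b * (1 - a)) := by
      rcases eq_or_lt_of_le hb.1 with h | h
      · have := upperCurve_spec (γ := γ) (a := 1 - a) (by linarith [ha.2])
          (by rw [lowerCurve] at h; linarith)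
        rw [show upperCurve γ (1 - a) = 1 - b by rw [← h, lowerCurve]; ring] at this
        linarith
      · exact ((lowerCurve_lt_iff ha.2 hab.le).1 h).le
    have : (a - b) ^ 2 ≤ a - b := by nlinarith [ha.1, ha.2]
    nlinarith [sq_nonneg (a + b - 1 - (a - b))]


/-! ### The bound as an integral of its slope -/

lemma upperBound_eq_fst {γ : ℝ} (hγ : γ ∈ Icc (0 : ℝ) 1) {a b : ℝ} (ha : a ∈ Icc (0 : ℝ) 1)
    (hb : b ∈ Icc (0 : ℝ) 1) (h : upperCurve γ a ≤ b) : upperBound γ a b = a := by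
  have hab := (le_upperCurve γ a).trans h
  rw [upperBound_eq_min hγ ha hb, min_eq_left hab, min_eq_left]
  by_contra! hlt
  exact h.not_gt ((mem_region_iff (by linarith [hγ.1]) ha).1 ⟨hlt, hlt.trans_le hab⟩).2

lemma upperBound_eq_snd {γ : ℝ} (hγ : γ ∈ Icc (0 : ℝ) 1) {a b : ℝ} (ha : a ∈ Icc (0 : ℝ) 1)
    (hb : b ∈ Icc (0 : ℝ) 1) (h : b ≤ lowerCurve γ a) : upperBound γ a b = b := by
  have hab := h.trans (lowerCurve_le γ a)
  rw [upperBound_eq_min hγ ha hb, min_eq_right hab, min_eq_left]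
  by_contra! hlt
  exact h.not_gt ((mem_region_iff (by linarith [hγ.1]) ha).1 ⟨hlt.trans_le hab, hlt⟩).1

lemma upperBound_eq_omega_of_mem {γ : ℝ} (hγ : γ ∈ Icc (0 : ℝ) 1) {a b : ℝ}
    (h : (a, b) ∈ region γ) : upperBound γ a b = omega γ a b := by
  obtain ⟨ha, hb⟩ := region_subset (by linarith [hγ.1]) h
  rw [upperBound_eq_min hγ ha hb]
  exact min_eq_right (le_min h.1.le h.2.le)

/-- The partial derivative of the bound in the first variable. -/
def slope (γ v a : ℝ) : ℝ :=
  if v < lowerCurve γ a then 0 else if v < upperCurve γ a then omegaFst γ a v else 1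

lemma slope_mem {γ : ℝ} (hγ : 0 ≤ γ) {a : ℝ} (ha : a ∈ Icc (0 : ℝ) 1) (v : ℝ) :
    slope γ v a ∈ Icc (0 : ℝ) 1 := by
  unfold slope
  split_ifs with h1 h2
  · simp
  · exact Ioo_subset_Icc_self (omegaFst_mem hγ ha ⟨not_lt.1 h1, h2.le⟩)
  · simp

lemma measurable_slope {γ : ℝ} (hγ : -1 < γ) (v : ℝ) : Measurable (slope γ v) := by
  have hc : Continuous fun a => omegaFst γ a v :=
    (continuous_omegaFst hγ).comp (by fun_prop : Continuous fun a => (a, v))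
  exact Measurable.ite (measurableSet_lt measurable_const (continuous_lowerCurve γ).measurable)
    measurable_const (Measurable.ite
      (measurableSet_lt measurable_const (continuous_upperCurve γ).measurable)
      hc.measurable measurable_const)

lemma integrableOn_slope {γ : ℝ} (hγ : 0 ≤ γ) (v : ℝ) {u : ℝ} (hu : u ≤ 1) :
    IntegrableOn (slope γ v) (Icc 0 u) := by
  refine Measure.integrableOn_of_bounded (M := 1) (by simp)
    (measurable_slope (by linarith) v).aestronglyMeasurable ?_
  filter_upwards [ae_restrict_mem measurableSet_Icc] with a ha
  have := slope_mem hγ ⟨ha.1, ha.2.trans hu⟩ v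
  rw [Real.norm_eq_abs, abs_of_nonneg this.1]
  exact this.2

lemma hasDerivAt_upperBound {γ : ℝ} (hγ : γ ∈ Icc (0 : ℝ) 1) {v : ℝ} (hv : v ∈ Icc (0 : ℝ) 1)
    {a : ℝ} (ha : a ∈ Ioo (0 : ℝ) 1) (hl : lowerCurve γ a ≠ v) (hu : upperCurve γ a ≠ v) :
    HasDerivAt (fun a => upperBound γ a v) (slope γ v a) a := by
  have hγ' : -1 < γ := by linarith [hγ.1]
  have hIoo : ∀ᶠ x in nhds a, x ∈ Icc (0 : ℝ) 1 := Icc_mem_nhds ha.1 ha.2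
  have hcl := (continuous_lowerCurve γ).continuousAt (x := a)
  have hcu := (continuous_upperCurve γ).continuousAt (x := a)
  unfold slope
  rcases hl.lt_or_gt with hl | hl
  · rw [if_neg hl.not_gt]
    rcases hu.lt_or_gt with hu | hu
    · rw [if_neg hu.not_gt]
      refine (hasDerivAt_id a).congr_of_eventuallyEq ?_
      filter_upwards [hIoo, hcu.eventually_lt continuousAt_const hu] with x hx hx'
      exact upperBound_eq_fst hγ hx hv hx'.le
    · rw [if_pos hu]
      refine (hasDerivAt_omega hγ' a v).congr_of_eventuallyEq ?_
      filter_upwards [hIoo, hcl.eventually_lt continuousAt_const hl,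
        continuousAt_const.eventually_lt hcu hu] with x hx h1 h2
      exact upperBound_eq_omega_of_mem hγ ((mem_region_iff hγ' hx).2 ⟨h1, h2⟩)
  · rw [if_pos hl]
    refine (hasDerivAt_const a v).congr_of_eventuallyEq ?_
    filter_upwards [hIoo, continuousAt_const.eventually_lt hcl hl] with x hx hx'
    exact upperBound_eq_snd hγ hx hv hx'.le

lemma upperBound_eq_integral {γ : ℝ} (hγ : γ ∈ Icc (0 : ℝ) 1) {u v : ℝ}
    (hu : u ∈ Icc (0 : ℝ) 1) (hv : v ∈ Icc (0 : ℝ) 1) :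
    upperBound γ u v = ∫ a in Icc 0 u, slope γ v a := by
  have hγ' : -1 < γ := by linarith [hγ.1]
  have hQ := isQuasiCopula_upperBound (γ := γ) ⟨hγ'.le, hγ.2⟩
  have hsub : ∀ {a}, a ∈ Icc 0 u → a ∈ Icc (0 : ℝ) 1 := fun h => ⟨h.1, h.2.trans hu.2⟩
  -- The slope can fail to be the derivative only where a boundary curve has height `v`; strict
  -- monotonicity allows at most one such point per curve.
  have hcount : ({a ∈ Icc (0 : ℝ) 1 | lowerCurve γ a = v} ∪
      {a ∈ Icc (0 : ℝ) 1 | upperCurve γ a = v}).Countable := by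
    refine (Subsingleton.finite ?_).countable.union (Subsingleton.finite ?_).countable
    · exact fun x hx y hy => (strictMonoOn_lowerCurve hγ').injOn hx.1 hy.1 (hx.2.trans hy.2.symm)
    · exact fun x hx y hy => (strictMonoOn_upperCurve hγ').injOn hx.1 hy.1 (hx.2.trans hy.2.symm)
  have := integral_eq_of_hasDerivAt_off_countable_of_le (fun a => upperBound γ a v) (slope γ v)
    hu.1 hcount
    (hQ.continuousOn_comp continuousOn_id continuousOn_const (fun _ h => hsub h) (fun _ _ => hv))
    (fun x hx => ?_) ?_
  · rw [intervalIntegral.integral_of_le hu.1, ← integral_Icc_eq_integral_Ioc,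
      hQ.zero_left v hv, sub_zero] at this
    exact this.symm
  · obtain ⟨⟨h0, h1⟩, hn⟩ := hx
    have hx1 := h1.trans_le hu.2
    refine hasDerivAt_upperBound hγ hv ⟨h0, hx1⟩ (fun h => hn (Or.inl ⟨⟨h0.le, hx1.le⟩, h⟩))
      (fun h => hn (Or.inr ⟨⟨h0.le, hx1.le⟩, h⟩))
  · exact (intervalIntegrable_iff_integrableOn_Icc_of_le hu.1).2 (integrableOn_slope hγ.1 v hu.2)

lemma lintegral_density {γ : ℝ} (hγ : 0 ≤ γ) {a x y : ℝ} (hxy : x ≤ y)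
    (h : ∀ b ∈ Ioo x y, (a, b) ∈ region γ) :
    ∫⁻ b in Ioo x y, ENNReal.ofReal (density γ a b) =
      ENNReal.ofReal (omegaFst γ a y - omegaFst γ a x) := by
  have hγ' : -1 < γ := by linarith
  have hc : Continuous fun b => density γ a b :=
    (continuous_density hγ').comp (by fun_prop : Continuous fun b => (a, b))
  have hint := intervalIntegral.integral_eq_sub_of_hasDerivAt
    (fun b _ => hasDerivAt_omegaFst hγ' a b) (hc.intervalIntegrable x y)
  rw [intervalIntegral.integral_of_le hxy, integral_Ioc_eq_integral_Ioo] at hint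
  rw [← hint, ofReal_integral_eq_lintegral_ofReal
    ((hc.integrableOn_Icc (a := x) (b := y)).mono_set Ioo_subset_Icc_self)]
  filter_upwards [ae_restrict_mem measurableSet_Ioo] with b hb
  exact (density_pos hγ (h b hb)).le

/-- The Lebesgue density of the absolutely continuous part. -/
def acDensity (γ : ℝ) : ℝ × ℝ → ENNReal :=
  (region γ).indicator fun p => ENNReal.ofReal (density γ p.1 p.2)

lemma measurable_acDensity {γ : ℝ} (hγ : -1 < γ) : Measurable (acDensity γ) :=
  ((continuous_density hγ).measurable.ennreal_ofReal).indicator (isOpen_region γ).measurableSet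

/-- The conditional mass at `a`: an absolutely continuous piece and two atoms. -/
lemma lintegral_acDensity_add {γ : ℝ} (hγ : 0 ≤ γ) {a v : ℝ} (ha : a ∈ Icc (0 : ℝ) 1) :
    (∫⁻ b in Icc 0 v, acDensity γ (a, b)) +
      ({a | upperCurve γ a ≤ v}.indicator
        (fun a => ENNReal.ofReal (1 - omegaFst γ a (upperCurve γ a))) a +
      {a | lowerCurve γ a ≤ v}.indicator
        (fun a => ENNReal.ofReal (omegaFst γ a (lowerCurve γ a))) a) =
      ENNReal.ofReal (slope γ v a) := by
  have hγ' : -1 < γ := by linarith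
  have hlu : lowerCurve γ a ≤ upperCurve γ a := (lowerCurve_le γ a).trans (le_upperCurve γ a)
  have hl0 := (lowerCurve_mem hγ' ha).1
  have hind : ∀ b, acDensity γ (a, b) = (Ioo (lowerCurve γ a) (upperCurve γ a)).indicator
      (fun b => ENNReal.ofReal (density γ a b)) b := by
    intro b
    unfold acDensity
    by_cases h : (a, b) ∈ region γ
    · rw [indicator_of_mem h, indicator_of_mem (s := Ioo _ _) ((mem_region_iff hγ' ha).1 h)]
    · rw [indicator_of_notMem h, indicator_of_notMem (s := Ioo _ _) (mt (mem_region_iff hγ' ha).2 h)]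
  have hmU := omegaFst_mem hγ ha ⟨hlu, le_rfl⟩
  have hmL := omegaFst_mem hγ ha ⟨le_rfl, hlu⟩
  -- Monotonicity in the height makes the differences of `omegaFst` nonnegative, so that
  -- `ENNReal.ofReal` is additive on them.
  have hmono : ∀ y ∈ Icc (lowerCurve γ a) (upperCurve γ a),
      omegaFst γ a (lowerCurve γ a) ≤ omegaFst γ a y := by
    intro y hy
    refine monotoneOn_of_deriv_nonneg (convex_Icc (lowerCurve γ a) (upperCurve γ a))
      (fun b _ => (hasDerivAt_omegaFst hγ' a b).continuousAt.continuousWithinAt)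
      (fun b _ => (hasDerivAt_omegaFst hγ' a b).differentiableAt.differentiableWithinAt)
      (fun b hb => ?_) ⟨le_rfl, hlu⟩ hy hy.1
    rw [interior_Icc] at hb
    rw [(hasDerivAt_omegaFst hγ' a b).deriv]
    exact (density_pos hγ ((mem_region_iff hγ' ha).2 hb)).le
  simp_rw [hind]
  rw [setLIntegral_indicator measurableSet_Ioo]
  unfold slope
  rcases lt_or_ge v (lowerCurve γ a) with h | h
  · have he : Ioo (lowerCurve γ a) (upperCurve γ a) ∩ Icc 0 v = ∅ := by
      ext b
      simp only [mem_inter_iff, mem_Ioo, mem_Icc, mem_empty_iff_false, iff_false]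
      rintro ⟨h1, h2⟩
      linarith
    rw [if_pos h, he, indicator_of_notMem (s := {a | upperCurve γ a ≤ v}) (fun h' => (h.trans_le hlu).not_ge h'),
      indicator_of_notMem (s := {a | lowerCurve γ a ≤ v}) (fun h' => h.not_ge h')]
    simp
  rw [if_neg h.not_gt, indicator_of_mem (s := {a | lowerCurve γ a ≤ v}) h]
  rcases lt_or_ge v (upperCurve γ a) with h' | h'
  · have he : Ioo (lowerCurve γ a) (upperCurve γ a) ∩ Icc 0 v = Ioc (lowerCurve γ a) v := by
      ext b
      simp only [mem_inter_iff, mem_Ioo, mem_Icc, mem_Ioc]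
      constructor
      · rintro ⟨h1, h2⟩; exact ⟨h1.1, h2.2⟩
      · rintro ⟨h1, h2⟩; exact ⟨⟨h1, h2.trans_lt h'⟩, hl0.trans h1.le, h2⟩
    rw [if_pos h', he,
      indicator_of_notMem (s := {a | upperCurve γ a ≤ v}) (fun k => h'.not_ge k), zero_add,
      ← setLIntegral_congr Ioo_ae_eq_Ioc,
      lintegral_density hγ h fun b hb => (mem_region_iff hγ' ha).2 ⟨hb.1, hb.2.trans h'⟩,
      ← ENNReal.ofReal_add (sub_nonneg.2 (hmono v ⟨h, h'.le⟩)) hmL.1.le, sub_add_cancel]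
  · have he : Ioo (lowerCurve γ a) (upperCurve γ a) ∩ Icc 0 v =
        Ioo (lowerCurve γ a) (upperCurve γ a) :=
      inter_eq_left.2 fun b hb => ⟨hl0.trans hb.1.le, hb.2.le.trans h'⟩
    rw [if_neg h'.not_gt, he, indicator_of_mem (s := {a | upperCurve γ a ≤ v}) h',
      lintegral_density hγ hlu fun b hb => (mem_region_iff hγ' ha).2 hb,
      ← ENNReal.ofReal_add (sub_nonneg.2 hmU.2.le) hmL.1.le,
      ← ENNReal.ofReal_add (sub_nonneg.2 (hmono _ ⟨hlu, le_rfl⟩)) (by linarith [hmU.2, hmL.1])]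
    congr 1
    ring

/-! ### The mass distribution and its Lebesgue decomposition -/

/-- The singular part of the mass distribution of the bound. -/
def boundSing (γ : ℝ) : Measure (ℝ × ℝ) :=
  curveMeasure (upperCurve γ) (fun a => 1 - omegaFst γ a (upperCurve γ a)) +
    curveMeasure (lowerCurve γ) (fun a => omegaFst γ a (lowerCurve γ a))

/-- The mass distribution of the bound. -/
def boundMeasure (γ : ℝ) : Measure (ℝ × ℝ) :=
  boundSing γ + volume.withDensity (acDensity γ)

lemma continuous_omegaFst_curve {γ : ℝ} (hγ : -1 < γ) {f : ℝ → ℝ} (hf : Continuous f) :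
    Continuous fun a => omegaFst γ a (f a) :=
  (continuous_omegaFst hγ).comp (by fun_prop : Continuous fun a => (a, f a))

lemma boundMeasure_rect {γ : ℝ} (hγ : γ ∈ Icc (0 : ℝ) 1) {u v : ℝ}
    (hu : u ∈ Icc (0 : ℝ) 1) (hv : v ∈ Icc (0 : ℝ) 1) :
    boundMeasure γ (Icc 0 u ×ˢ Icc 0 v) = ENNReal.ofReal (upperBound γ u v) := by
  have hγ' : -1 < γ := by linarith [hγ.1]
  have hU := continuous_upperCurve γ
  have hL := continuous_lowerCurve γ
  have hm := measurable_acDensity hγ'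
  have hmU : Measurable fun a => {a | upperCurve γ a ≤ v}.indicator
      (fun a => ENNReal.ofReal (1 - omegaFst γ a (upperCurve γ a))) a :=
    ((measurable_const.sub (continuous_omegaFst_curve hγ' hU).measurable).ennreal_ofReal).indicator
      (measurableSet_le hU.measurable measurable_const)
  rw [boundMeasure, boundSing, Measure.add_apply, Measure.add_apply,
    curveMeasure_rect hU _ (fun _ h => upperCurve_mem hγ' h) hu.2,
    curveMeasure_rect hL _ (fun _ h => lowerCurve_mem hγ' h) hu.2,
    withDensity_apply _ (measurableSet_Icc.prod measurableSet_Icc), Measure.volume_eq_prod,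
    setLIntegral_prod _ hm.aemeasurable, add_comm, ← lintegral_add_left hmU,
    ← lintegral_add_left (hm.lintegral_prod_right' (ν := volume.restrict (Icc 0 v))),
    upperBound_eq_integral hγ hu hv,
    ofReal_integral_eq_lintegral_ofReal (integrableOn_slope hγ.1 v hu.2)]
  · exact setLIntegral_congr_fun measurableSet_Icc fun a ha =>
      lintegral_acDensity_add hγ.1 ⟨ha.1, ha.2.trans hu.2⟩
  · filter_upwards [ae_restrict_mem measurableSet_Icc] with a ha
    exact (slope_mem hγ.1 ⟨ha.1, ha.2.trans hu.2⟩ v).1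

/-- By `lintegral_acDensity_add` the slope at height `v` is the conditional mass of `[0, v]`, hence
nondecreasing in `v`. -/
lemma slope_mono {γ : ℝ} (hγ : 0 ≤ γ) {a v₁ v₂ : ℝ} (ha : a ∈ Icc (0 : ℝ) 1)
    (hv : v₁ ≤ v₂) :
    slope γ v₁ a ≤ slope γ v₂ a := by
  rw [← ENNReal.ofReal_le_ofReal_iff (slope_mem hγ ha v₂).1,
    ← lintegral_acDensity_add hγ ha (v := v₁),
    ← lintegral_acDensity_add hγ ha (v := v₂)]
  refine add_le_add (lintegral_mono_set (Icc_subset_Icc_right hv)) (add_le_add ?_ ?_) <;>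
    exact indicator_le_indicator_of_subset (fun _ h => le_trans h hv) (fun _ => zero_le) _

lemma isCopula_upperBound {γ : ℝ} (hγ : γ ∈ Icc (0 : ℝ) 1) : IsCopula (upperBound γ) := by
  have hQ := isQuasiCopula_upperBound (γ := γ) ⟨by linarith [hγ.1], hγ.2⟩
  refine ⟨hQ.zero_left, hQ.zero_right, hQ.one_left, hQ.one_right, ?_⟩
  intro u₁ hu₁ u₂ hu₂ v₁ hv₁ v₂ hv₂ hu hv
  have hi : ∀ v, ∀ u ∈ Icc (0 : ℝ) 1, IntegrableOn (slope γ v) (Icc 0 u) :=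
    fun v u hu => integrableOn_slope hγ.1 v hu.2
  have key : ∀ u ∈ Icc (0 : ℝ) 1, upperBound γ u v₂ - upperBound γ u v₁ =
      ∫ a in Icc 0 u, (slope γ v₂ a - slope γ v₁ a) := by
    intro u hu
    rw [upperBound_eq_integral hγ hu hv₁, upperBound_eq_integral hγ hu hv₂,
      integral_sub (hi v₂ u hu) (hi v₁ u hu)]
  have hsub : Icc 0 u₁ ⊆ Icc 0 u₂ := Icc_subset_Icc_right hu
  have hle := setIntegral_mono_set ((hi v₂ u₂ hu₂).sub (hi v₁ u₂ hu₂)) ?_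
    hsub.eventuallyLE
  · simp only [Pi.sub_apply] at hle
    rw [← key u₁ hu₁, ← key u₂ hu₂] at hle
    linarith
  · filter_upwards [ae_restrict_mem measurableSet_Icc] with a ha
    exact sub_nonneg.2 (slope_mono hγ.1 ⟨ha.1, ha.2.trans hu₂.2⟩ hv)

lemma boundSing_mutuallySingular (γ : ℝ) : boundSing γ ⟂ₘ volume :=
  (curveMeasure_mutuallySingular (continuous_upperCurve γ) _).add_left
    (curveMeasure_mutuallySingular (continuous_lowerCurve γ) _)

/-- Uniqueness of the Lebesgue decomposition identifies the pieces from which `boundMeasure` was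
built. -/
lemma singPart_boundMeasure {γ : ℝ} (hγ : -1 < γ) : singPart (boundMeasure γ) = boundSing γ :=
  (Measure.eq_singularPart (measurable_acDensity hγ) (boundSing_mutuallySingular γ) rfl).symm

lemma acPart_boundMeasure {γ : ℝ} (hγ : -1 < γ) :
    acPart (boundMeasure γ) = volume.withDensity (acDensity γ) :=
  (Measure.eq_withDensity_rnDeriv (measurable_acDensity hγ)
    (boundSing_mutuallySingular γ) rfl).symm

lemma withDensity_acDensity_compl (γ : ℝ) :
    volume.withDensity (acDensity γ) (region γ)ᶜ = 0 := by
  rw [withDensity_apply _ (isOpen_region γ).measurableSet.compl, acDensity,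
    setLIntegral_indicator (isOpen_region γ).measurableSet]
  simp

lemma support_withDensity_acDensity {γ : ℝ} (hγ : 0 ≤ γ) :
    (volume.withDensity (acDensity γ)).support = closure (region γ) := by
  refine (Measure.support_subset_of_isClosed isClosed_closure (mem_ae_iff.2
    (measure_mono_null (compl_subset_compl.2 subset_closure)
      (withDensity_acDensity_compl γ)))).antisymm fun p hp => ?_
  rw [Measure.mem_support_iff_forall]
  intro U hU
  rw [pos_iff_ne_zero]
  intro h0
  rw [withDensity_apply_eq_zero (measurable_acDensity (by linarith))] at h0
  refine (measure_pos_of_mem_closure_open (μ := volume) (isOpen_region γ) hp hU).ne'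
    (measure_mono_null ?_ h0)
  rintro x ⟨hx, hxU⟩
  refine ⟨?_, hxU⟩
  rw [mem_ofPred_eq, acDensity, indicator_of_mem hx]
  exact (ENNReal.ofReal_pos.2 (density_pos hγ hx)).ne'

lemma support_boundSing {γ : ℝ} (hγ : 0 ≤ γ) : (boundSing γ).support = curves γ := by
  have hγ' : -1 < γ := by linarith
  have hU := continuous_upperCurve γ
  have hL := continuous_lowerCurve γ
  have hlu : ∀ a, lowerCurve γ a ≤ upperCurve γ a :=
    fun a => (lowerCurve_le γ a).trans (le_upperCurve γ a)
  rw [boundSing, Measure.support_add,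
    support_curveMeasure (w := fun a => 1 - omegaFst γ a (upperCurve γ a)) hU
      (continuous_const.sub (continuous_omegaFst_curve hγ' hU))
      fun a ha => sub_pos.2 (omegaFst_mem hγ ha ⟨hlu a, le_rfl⟩).2,
    support_curveMeasure hL (continuous_omegaFst_curve hγ' hL)
      fun a ha => (omegaFst_mem hγ ha ⟨le_rfl, hlu a⟩).1]
  ext p
  exact and_or_left.symm

lemma boundMeasure_compl_square {γ : ℝ} (hγ : -1 < γ) :
    boundMeasure γ (Icc (0 : ℝ) 1 ×ˢ Icc (0 : ℝ) 1)ᶜ = 0 := by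
  rw [boundMeasure, boundSing, Measure.add_apply, Measure.add_apply, add_eq_zero, add_eq_zero]
  refine ⟨⟨measure_mono_null (compl_subset_compl.2 ?_)
      (curveMeasure_compl_curve (continuous_upperCurve γ) _),
    measure_mono_null (compl_subset_compl.2 ?_)
      (curveMeasure_compl_curve (continuous_lowerCurve γ) _)⟩,
    measure_mono_null (compl_subset_compl.2 (region_subset hγ)) (withDensity_acDensity_compl γ)⟩
  · exact fun p hp => ⟨hp.1, hp.2 ▸ upperCurve_mem hγ hp.1⟩
  · exact fun p hp => ⟨hp.1, hp.2 ▸ lowerCurve_mem hγ hp.1⟩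

lemma isMassDistribution_boundMeasure {γ : ℝ} (hγ : γ ∈ Icc (0 : ℝ) 1) :
    IsMassDistribution (upperBound γ) (boundMeasure γ) where
  prob := ⟨by
    have hγ' : -1 < γ := by linarith [hγ.1]
    rw [← measure_add_measure_compl (μ := boundMeasure γ) (s := Icc (0 : ℝ) 1 ×ˢ Icc (0 : ℝ) 1)
      (measurableSet_Icc.prod measurableSet_Icc), boundMeasure_compl_square hγ',
      boundMeasure_rect hγ (by simp) (by simp),
      (isQuasiCopula_upperBound ⟨hγ'.le, hγ.2⟩).one_left 1 (by simp)]
    simp⟩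
  compl_square := boundMeasure_compl_square (by linarith [hγ.1])
  apply_rect _ hu _ hv := boundMeasure_rect hγ hu hv

lemma not_absolutelyContinuous_boundMeasure {γ : ℝ} (hγ : 0 ≤ γ) :
    ¬ boundMeasure γ ≪ volume := by
  intro h
  have h0 : singPart (boundMeasure γ) = 0 := Measure.singularPart_eq_zero_of_ac h
  have hs := support_boundSing hγ
  rw [← singPart_boundMeasure (by linarith), h0, Measure.support_zero] at hs
  have : ((0, upperCurve γ 0) : ℝ × ℝ) ∈ curves γ := ⟨by simp, Or.inl rfl⟩
  rw [← hs] at this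
  exact this

/-- At the centre `W` is `0` and `M` is `1/2`, so this value separates the bound from both. -/
lemma upperBound_half {γ : ℝ} (hγ : γ ∈ Ico (0 : ℝ) (1 / 2)) :
    0 < upperBound γ (1 / 2) (1 / 2) ∧ upperBound γ (1 / 2) (1 / 2) < 1 / 2 := by
  have hγ' : -1 < γ := by linarith [hγ.1]
  have hc := center_mem_region hγ' hγ.2
  rw [upperBound_eq_omega_of_mem ⟨hγ.1, by linarith [hγ.2]⟩ hc]
  exact ⟨omega_pos hγ' _ _, hc.1⟩

end GiniBound

end

theorem corollary8 :
    -- (i) extreme values of the parameter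
    (GiniBound.EqOnSquare (GiniBound.upperBound (-1)) GiniBound.W ∧
      ∀ γ ∈ Set.Icc (1 / 2 : ℝ) 1,
        GiniBound.EqOnSquare (GiniBound.upperBound γ) GiniBound.M) ∧
    -- (ii) proper quasi-copula
    (∀ γ ∈ Set.Ioo (-1 : ℝ) 0, GiniBound.IsProperQuasiCopula (GiniBound.upperBound γ)) ∧
    -- (iii) copula with a singular component, and the location of its mass
    (∀ γ ∈ Set.Ico (0 : ℝ) (1 / 2),
      GiniBound.IsCopula (GiniBound.upperBound γ) ∧
      ¬ GiniBound.EqOnSquare (GiniBound.upperBound γ) GiniBound.W ∧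
      ¬ GiniBound.EqOnSquare (GiniBound.upperBound γ) GiniBound.M ∧
      (IsOpen (GiniBound.region γ) ∧ IsConnected (GiniBound.region γ) ∧
        GiniBound.region γ ⊆ Set.Icc (0 : ℝ) 1 ×ˢ Set.Icc (0 : ℝ) 1 ∧
        frontier (GiniBound.region γ) ⊆ GiniBound.hyperbolas γ) ∧
      ∃ μ : MeasureTheory.Measure (ℝ × ℝ),
        GiniBound.IsMassDistribution (GiniBound.upperBound γ) μ ∧
        ¬ MeasureTheory.Measure.AbsolutelyContinuous μ MeasureTheory.volume ∧
        GiniBound.acPart μ (GiniBound.region γ)ᶜ = 0 ∧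
        (GiniBound.acPart μ).support = closure (GiniBound.region γ) ∧
        (GiniBound.singPart μ).support =
          frontier (GiniBound.region γ) ∪
            (GiniBound.diagonal \ closure (GiniBound.region γ))) ∧
    -- (iv) monotonicity in the parameter
    (∀ γ ∈ Set.Icc (-1 : ℝ) 1, ∀ γ' ∈ Set.Icc (-1 : ℝ) 1, γ ≤ γ' →
      GiniBound.ConcordanceLE (GiniBound.upperBound γ) (GiniBound.upperBound γ')) ∧
    -- (v) symmetries
    (∀ γ ∈ Set.Icc (-1 : ℝ) 1,
      GiniBound.IsSymmetric (GiniBound.upperBound γ) ∧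
      GiniBound.IsRadiallySymmetric (GiniBound.upperBound γ)) ∧
    -- (vi) Gini's gamma of the bound, extended to quasi-copulas
    (∀ γ ∈ Set.Ioo (-1 : ℝ) 1, γ < GiniBound.gini (GiniBound.upperBound γ)) := by
  refine ⟨⟨GiniBound.upperBound_neg_one, fun γ hγ => GiniBound.upperBound_of_half_le hγ⟩,
    fun γ hγ => ⟨GiniBound.isQuasiCopula_upperBound ⟨hγ.1.le, hγ.2.le.trans zero_le_one⟩,
      GiniBound.not_isCopula_upperBound hγ⟩, fun γ hγ => ?_,
    fun γ hγ γ' hγ' h => GiniBound.concordanceLE_upperBound hγ hγ' h,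
    fun γ hγ => ⟨GiniBound.isSymmetric_upperBound hγ, GiniBound.isRadiallySymmetric_upperBound hγ⟩,
    fun γ hγ => GiniBound.lt_gini_upperBound hγ⟩
  have hγ1 : -1 < γ := by linarith [hγ.1]
  have hγ2 : γ ∈ Set.Icc (0 : ℝ) 1 := ⟨hγ.1, by linarith [hγ.2]⟩
  have hhalf : (1 / 2 : ℝ) ∈ Set.Icc (0 : ℝ) 1 := by norm_num
  obtain ⟨h0, h1⟩ := GiniBound.upperBound_half hγ
  refine ⟨GiniBound.isCopula_upperBound hγ2, fun h => ?_, fun h => ?_,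
    ⟨GiniBound.isOpen_region γ, GiniBound.isConnected_region hγ1 hγ.2,
      GiniBound.region_subset hγ1, GiniBound.frontier_region_subset γ⟩,
    GiniBound.boundMeasure γ, GiniBound.isMassDistribution_boundMeasure hγ2,
    GiniBound.not_absolutelyContinuous_boundMeasure hγ.1, ?_, ?_, ?_⟩
  · rw [h _ hhalf _ hhalf] at h0
    norm_num [GiniBound.W] at h0
  · rw [h _ hhalf _ hhalf] at h1
    norm_num [GiniBound.M] at h1
  · rw [GiniBound.acPart_boundMeasure hγ1]
    exact GiniBound.withDensity_acDensity_compl γ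
  · rw [GiniBound.acPart_boundMeasure hγ1]
    exact GiniBound.support_withDensity_acDensity hγ.1
  · rw [GiniBound.singPart_boundMeasure hγ1, GiniBound.support_boundSing hγ.1,
      GiniBound.frontier_union_diagonal hγ1]
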